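/- Corollary 1. Let $d\ge 1$ and $n\ge 2$. A detector is a POVM $\{P_i\}_{i=1}^n$ on $\mathbb C^d$ ($P_i\ge 0$, $\sum_i P_i=I$), and the fidelity of an estimate $\hat P$ of a POVM element $P\neq 0$ is $$F(\hat P,P)=\frac{\big[\operatorname{Tr}\sqrt{\sqrt{\hat P}\,P\,\sqrt{\hat P}}\,\big]^2}{\operatorname{Tr}(P)\operatorname{Tr}(\hat P)}-\frac{[\operatorname{Tr}(P-\hat P)]^2}{d^2},$$ where the quotient is read as $0$ if $\hat P=0$. The infidelity is $1-F(\hat P,P)$. *Two-stage reconstruction.* Given the relative frequencies $\hat p_{ij}$ of outcome $i$ on probe states $\rho_1,\dots,\rho_M$ and an orthonormal basis $\{\Omega_a\}_{a=1}^{d^2}$ of Hermitian operators, let $X_{ja}=\operatorname{Tr}(\rho_j\Omega_a)$, $\hat y_i=(\hat p_{i1},\dots,\hat p_{iM})^T$, $y_0=(1,\dots,1)^T$, $\delta_a=\operatorname{Tr}(\Omega_a)$, $$\hat\theta_i=(X^TX)^{-1}X^T\big(\hat y_i-\tfrac1n y_0\big)+\tfrac1n\delta,\qquad \hat E_i=\sum_a\hat\theta_i^a\,\Omega_a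 .$$ Write $\hat E_i=\hat F_i-\hat G_i$ with $\hat F_i,\hat G_i\ge 0$ the positive and negative parts of $\hat E_i$. With $S=\sqrt{I+\sum_k\hat G_k}$, the estimate is $\hat P_i=S^{-1}\hat F_iS^{-1}$. (Equivalently $\hat P_i=U^\dagger C^{-1}\hat F_iC^{-\dagger}U$ for any $C$ with $CC^\dagger=I+\sum_k\hat G_k$ and $U=\sqrt{C^\dagger C}\,C^{-1}$.) *Two-step procedure for the element $P=P_i$.* Fix probe states $\rho_1,\dots,\rho_M$ whose real span contains every Hermitian matrix. Of $N$ copies, $N_0=\lfloor\alpha N\rfloor$ are used in Step 1, $\lfloor N_0/M\rfloor$ copies for each $\rho_j$. A reconstruction algorithm computes from the outcomes an estimate $\tilde P$ of $P$, and one takes an orthonormal basis $|1\rangle,\dots,|d\rangle$ of eigenvectors of $\tilde P$. In Step 2, $\lfloor (N-N_0)/d^2\rfloor$ copies are used for each of the $d^2$ generalized-Pauli-basis (GPB) states $$|k\rangle\langle k|,\qquad \tfrac12\big(|k\rangle\langle l|+|l\rangle\langle k|+|k\rangle\langle k|+|l\rangle\langle l|\big),\qquad \tfrac12\big(-\mathrm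 i|k\rangle\langle l|+\mathrm i|l\rangle\langle k|+|k\rangle\langle k|+|l\rangle\langle l|\big)\qquad(k<l),$$ and $\hat P$ is the two-stage estimate of $P$ from the Step 2 data. All copies are measured independently, with probabilities given by Born's rule. *Claim.* Let $\{P_i\}$ be any POVM, $P=P_i\ne 0$ any nonzero element of it, of any rank, and $0<\alpha<1$. Suppose that the Step 1 algorithm, when used with $m$ copies of each $\rho_j$, has mean squared error $\mathbb E\|\tilde P-P\|^2=O(1/m)$ as $m\to\infty$. (The two-stage algorithm is one that has this property.) Then, for every choice of the eigenbases, $$\mathbb E\big(1-F(\hat P,P)\big)=O(1/N)\qquad(N\to\infty).$$ This rate is optimal: for each index $i$, and for every adaptive procedure that for each $N$ measures $N$ states one after the other, each chosen from the previous outcomes, and then computes from the outcomes an estimate $\hat P\ge 0$ of $P_i$, there is a POVM with $P_i\neq0$ at which $\mathbb E(1-F(\hat P,P_i))$ is not $o(1/N)$. -/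

import Mathlib

open Matrix Filter Asymptotics
open scoped ComplexOrder

noncomputable section

namespace QDT

/-- Operators on a `d`-dimensional quantum system. -/
abbrev Op (d : ℕ) := Matrix (Fin d) (Fin d) ℂ

/-- Quantum states (density matrices). -/
structure IsState {d : ℕ} (ρ : Op d) : Prop where
  posSemidef : ρ.PosSemidef
  trace_eq_one : ρ.trace = 1

/-- A detector with `n` outcomes: positive semidefinite operators that sum to the identity. -/
structure IsPOVM {d n : ℕ} (P : Fin n → Op d) : Prop where
  posSemidef : ∀ i, (P i).PosSemidef
  sum_eq_one : ∑ i, P i = 1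

/-- Square root of a positive semidefinite matrix, through its spectral decomposition. -/
def matSqrt {d : ℕ} (A : Op d) : Op d := cfc Real.sqrt A

/-- Positive part: the nonpositive eigenvalues of a Hermitian matrix are replaced by zero. -/
def matPosPart {d : ℕ} (A : Op d) : Op d := cfc (fun x : ℝ => max x 0) A

/-- Negative part, so that `A = matPosPart A - matNegPart A` for a Hermitian matrix `A`. -/
def matNegPart {d : ℕ} (A : Op d) : Op d := cfc (fun x : ℝ => max (-x) 0) A

/-- Squared Frobenius norm `Tr (A† A)`. -/
def frobSq {d : ℕ} (A : Op d) : ℝ := (Aᴴ * A).trace.re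

/-- Detector fidelity of an estimate `Q` and a true POVM element `P`:
`[Tr √(√Q P √Q)]² / (Tr P · Tr Q) - [Tr (P - Q)]² / d²`.
If `Q = 0`, the quotient is read as `0` (its numerator vanishes). -/
def fidelity {d : ℕ} (Q P : Op d) : ℝ :=
  (matSqrt (matSqrt Q * P * matSqrt Q)).trace.re ^ 2 / (P.trace.re * Q.trace.re)
    - (P - Q).trace.re ^ 2 / (d : ℝ) ^ 2

/-- Infidelity `1 - F`. -/
def infidelity {d : ℕ} (Q P : Op d) : ℝ := 1 - fidelity Q P

/-! ### Measurement data -/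

/-- Born's rule: probability of the outcome `i` on the state `ρ`. -/
def born {d n : ℕ} (P : Fin n → Op d) (ρ : Op d) (i : Fin n) : ℝ := (P i * ρ).trace.re

/-- Measurement data: `m` copies of each probe state `j : J` are measured, and
`ω j c` is the outcome for copy `c` of state `j`. -/
abbrev Data (J : Type) (m n : ℕ) := J → Fin m → Fin n

/-- Probability of the data `ω`: all copies are measured independently. -/
def dataProb {d n m : ℕ} {J : Type} [Fintype J]
    (P : Fin n → Op d) (ρ : J → Op d) (ω : Data J m n) : ℝ :=
  ∏ j, ∏ c, born P (ρ j) (ω j c)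

/-- Expectation of a function of the data. -/
def expect {d n : ℕ} {J : Type} [Fintype J] [DecidableEq J]
    (P : Fin n → Op d) (ρ : J → Op d) (m : ℕ) (f : Data J m n → ℝ) : ℝ :=
  ∑ ω : Data J m n, dataProb P ρ ω * f ω

/-- Observed relative frequency of the outcome `i` on the state `j`. -/
def freq {n m : ℕ} {J : Type} (ω : Data J m n) (i : Fin n) (j : J) : ℝ :=
  ((Finset.univ.filter fun c => ω j c = i).card : ℝ) / (m : ℝ)

/-- Complete or over-complete probe states: their real span contains every Hermitian matrix. -/
def SpansHermitian {d : ℕ} {J : Type} (ρ : J → Op d) : Prop :=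
  ∀ H : Op d, H.IsHermitian → H ∈ Submodule.span ℝ (Set.range ρ)

/-! ### Two-stage reconstruction -/

/-- `d²` Hermitian operators that are orthonormal for `⟨A, B⟩ = Tr (A† B)`, hence a basis. -/
structure IsOperatorBasis {d : ℕ} (Ω : Fin d × Fin d → Op d) : Prop where
  isHermitian : ∀ a, (Ω a).IsHermitian
  orthonormal : ∀ a b, ((Ω a)ᴴ * Ω b).trace = if a = b then 1 else 0

/-- Coordinates `Tr (A Ω_a)` of a Hermitian matrix. -/
def coords {d : ℕ} (Ω : Fin d × Fin d → Op d) (A : Op d) : Fin d × Fin d → ℝ :=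
  fun a => (A * Ω a).trace.re

/-- The matrix `X` of the regression model; row `j` parametrizes the probe state `ρ j`. -/
def designMatrix {d : ℕ} {J : Type} (Ω : Fin d × Fin d → Op d) (ρ : J → Op d) :
    Matrix J (Fin d × Fin d) ℝ :=
  Matrix.of fun j a => coords Ω (ρ j) a

/-- Constrained least squares solution for outcome `i`:
`θ_i = (XᵀX)⁻¹ Xᵀ (y_i - y₀ / n) + 𝒹 / n`, where `y_i` are the frequencies, `y₀ = (1, …, 1)`
and `𝒹` parametrizes the identity (so `𝒹 = (√d, 0, …, 0)` if `I / √d` is the first basis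
element). -/
def clsCoords {d n m : ℕ} {J : Type} [Fintype J]
    (Ω : Fin d × Fin d → Op d) (ρ : J → Op d) (ω : Data J m n) (i : Fin n) :
    Fin d × Fin d → ℝ :=
  let X := designMatrix Ω ρ
  ((Xᵀ * X)⁻¹ * Xᵀ) *ᵥ (fun j => freq ω i j - 1 / (n : ℝ)) + (1 / (n : ℝ)) • coords Ω 1

/-- First stage: the Hermitian, possibly unphysical, estimate `E_i = ∑ₐ θ_i^a Ω_a`. -/
def stageOne {d n m : ℕ} {J : Type} [Fintype J]
    (Ω : Fin d × Fin d → Op d) (ρ : J → Op d) (ω : Data J m n) (i : Fin n) : Op d :=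
  ∑ a, (clsCoords Ω ρ ω i a : ℂ) • Ω a

/-- Second stage: with `F_i`, `G_i` the positive and negative parts of `E_i` and
`S = √(I + ∑ G_i)`, the physical estimate is `S⁻¹ F_i S⁻¹`. The lemma
`stageTwo_eq_of_factor` identifies it with the form `U† C⁻¹ F_i C⁻† U`. -/
def stageTwo {d n : ℕ} (E : Fin n → Op d) (i : Fin n) : Op d :=
  let S := matSqrt (1 + ∑ k, matNegPart (E k))
  S⁻¹ * matPosPart (E i) * S⁻¹

/-- The two-stage reconstruction algorithm. -/
def twoStage {d n m : ℕ} {J : Type} [Fintype J]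
    (Ω : Fin d × Fin d → Op d) (ρ : J → Op d) (ω : Data J m n) : Fin n → Op d :=
  stageTwo (stageOne Ω ρ ω)

/-- Mean squared error `𝔼 ‖P̂_i - P_i‖²` of a reconstruction `A`. -/
def mse {d n : ℕ} {J : Type} [Fintype J] [DecidableEq J] (P : Fin n → Op d) (ρ : J → Op d)
    (m : ℕ) (A : Data J m n → Fin n → Op d) (i : Fin n) : ℝ :=
  expect P ρ m fun ω => frobSq (A ω i - P i)

/-! ### The adaptive procedure -/

/-- `b` is an orthonormal basis of eigenvectors of `A`, with real eigenvalues. -/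
structure IsEigenbasis {d : ℕ} (A : Op d) (b : Fin d → Fin d → ℂ) : Prop where
  orthonormal : ∀ k l, star (b k) ⬝ᵥ b l = if k = l then 1 else 0
  eigen : ∀ k, ∃ μ : ℝ, A *ᵥ b k = (μ : ℂ) • b k

/-- `|u⟩⟨v|`. -/
def ketBra {d : ℕ} (u v : Fin d → ℂ) : Op d := vecMulVec u (star v)

/-- The `d²` generalized Pauli basis states of the orthonormal basis `b`:
`|k⟩⟨k|`, and for `k < l` the states
`(|k⟩⟨l| + |l⟩⟨k| + |k⟩⟨k| + |l⟩⟨l|) / 2` (at the index `(k, l)`) and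
`(-i|k⟩⟨l| + i|l⟩⟨k| + |k⟩⟨k| + |l⟩⟨l|) / 2` (at the index `(l, k)`). -/
def gpb {d : ℕ} (b : Fin d → Fin d → ℂ) (a : Fin d × Fin d) : Op d :=
  let k := min a.1 a.2
  let l := max a.1 a.2
  if a.1 = a.2 then ketBra (b k) (b k)
  else if a.1 < a.2 then
    (1 / 2 : ℂ) • (ketBra (b k) (b l) + ketBra (b l) (b k)
      + ketBra (b k) (b k) + ketBra (b l) (b l))
  else
    (1 / 2 : ℂ) • ((-Complex.I) • ketBra (b k) (b l) + Complex.I • ketBra (b l) (b k)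
      + ketBra (b k) (b k) + ketBra (b l) (b l))

/-- Expected infidelity `𝔼 (1 - F(P̂_i, P_i))` of the two-step procedure aimed at element `i`.
Step 1 measures `m₁` copies of each state `ρ j` and passes on the orthonormal basis `b ω`;
Step 2 measures `m₂` copies of each generalized Pauli basis state of `b ω`, and
the two-stage algorithm computes `P̂` from the Step 2 data. -/
def adaptiveInfidelity {d n : ℕ} {J : Type} [Fintype J] [DecidableEq J]
    (Ω : Fin d × Fin d → Op d) (P : Fin n → Op d) (i : Fin n) (ρ : J → Op d) (m₁ m₂ : ℕ)
    (b : Data J m₁ n → Fin d → Fin d → ℂ) : ℝ :=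
  expect P ρ m₁ fun ω₁ =>
    expect P (gpb (b ω₁)) m₂ fun ω₂ =>
      infidelity (twoStage Ω (gpb (b ω₁)) ω₂ i) (P i)

/-! ### General adaptive procedures, for the optimality of the rate -/

/-- Probability of the outcomes `ω` of `N` successive measurements, where the state `σ h` is
measured after the outcomes `h`. -/
def sequentialProb {d n N : ℕ} (P : Fin n → Op d) (σ : List (Fin n) → Op d)
    (ω : Fin N → Fin n) : ℝ :=
  ∏ k : Fin N, born P (σ ((List.ofFn ω).take k)) (ω k)

/-- Expected infidelity, for element `i`, of the estimate `Q ω` computed from the outcomes of `N`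
successive measurements. -/
def sequentialInfidelity {d n : ℕ} (P : Fin n → Op d) (i : Fin n) (N : ℕ)
    (σ : List (Fin n) → Op d) (Q : (Fin N → Fin n) → Op d) : ℝ :=
  ∑ ω : Fin N → Fin n, sequentialProb P σ ω * infidelity (Q ω) (P i)

/-! ### The second stage does not depend on the factorization -/

theorem matSqrt_unique {d : ℕ} {A B : Op d} (hB : B.PosSemidef) (h : B * B = A) :
    matSqrt A = B := by
  have hsa : IsSelfAdjoint B := hB.1
  unfold matSqrt
  subst h
  have e1 : B * B = cfc (fun x : ℝ => x * x) B := by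
    rw [cfc_mul (fun x : ℝ => x) (fun x : ℝ => x) B, cfc_id' ℝ B]
  rw [e1, ← cfc_comp Real.sqrt (fun x : ℝ => x * x) B]
  have : Set.EqOn (Real.sqrt ∘ fun x : ℝ => x * x) id (spectrum ℝ B) := by
    intro x hx
    have hx0 : 0 ≤ x := by
      rw [hB.1.spectrum_real_eq_range_eigenvalues] at hx
      obtain ⟨k, rfl⟩ := hx
      exact hB.eigenvalues_nonneg k
    simp [Real.sqrt_mul_self hx0]
  rw [cfc_congr this, cfc_id ℝ B]

open scoped MatrixOrder in
theorem cfc_posSemidef {d : ℕ} (f : ℝ → ℝ) (A : Op d) (h : ∀ x ∈ spectrum ℝ A, 0 ≤ f x) :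
    (cfc f A).PosSemidef :=
  Matrix.nonneg_iff_posSemidef.mp (cfc_nonneg h)

theorem matSqrt_spec {d : ℕ} {A : Op d} (hA : A.PosSemidef) :
    (matSqrt A).PosSemidef ∧ matSqrt A * matSqrt A = A := by
  refine ⟨cfc_posSemidef _ _ fun x _ => Real.sqrt_nonneg x, ?_⟩
  have hsa : IsSelfAdjoint A := hA.1
  unfold matSqrt
  rw [← cfc_mul Real.sqrt Real.sqrt A]
  have : Set.EqOn (fun x : ℝ => Real.sqrt x * Real.sqrt x) id (spectrum ℝ A) := by
    intro x hx
    rw [hA.1.spectrum_real_eq_range_eigenvalues] at hx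
    obtain ⟨k, rfl⟩ := hx
    exact Real.mul_self_sqrt (hA.eigenvalues_nonneg k)
  rw [cfc_congr this, cfc_id ℝ A]

/-- For every `C` with `C C† = I + ∑ G_k` (which is `∑ F_k` if the `E_k` sum to the identity) and
the unitary `U = √(C†C) C⁻¹`, the operator `U† (C⁻¹ F_i C⁻†) U` is the second stage estimate. -/
theorem stageTwo_eq_of_factor {d n : ℕ} (E : Fin n → Op d) (i : Fin n) (C : Op d)
    (hC : C * Cᴴ = 1 + ∑ k, matNegPart (E k)) :
    let U := matSqrt (Cᴴ * C) * C⁻¹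
    Uᴴ * (C⁻¹ * matPosPart (E i) * (C⁻¹)ᴴ) * U = stageTwo E i := by
  intro U
  have hpd : (C * Cᴴ).PosDef := by
    rw [hC]
    exact Matrix.PosDef.one.add_posSemidef
      (Matrix.posSemidef_sum _ fun k _ => cfc_posSemidef _ _ fun x _ => le_max_right _ _)
  have hdet : IsUnit C.det := by
    have h := (Matrix.isUnit_iff_isUnit_det _).mp hpd.isUnit
    rw [Matrix.det_mul] at h
    exact isUnit_of_mul_isUnit_left h
  have hC1 : C * C⁻¹ = 1 := Matrix.mul_nonsing_inv C hdet
  have hC2 : C⁻¹ * C = 1 := Matrix.nonsing_inv_mul C hdet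
  obtain ⟨hR, hRR⟩ := matSqrt_spec (Matrix.posSemidef_conjTranspose_mul_self C)
  have hRh : (matSqrt (Cᴴ * C))ᴴ = matSqrt (Cᴴ * C) := hR.1
  have hU : U = matSqrt (Cᴴ * C) * C⁻¹ := rfl
  clear_value U
  generalize matSqrt (Cᴴ * C) = R at hR hRR hRh hU
  have hD : (C⁻¹)ᴴ * Cᴴ = 1 := by
    rw [← Matrix.conjTranspose_mul, hC1, Matrix.conjTranspose_one]
  have hUU : Uᴴ * U = 1 := by
    rw [hU, Matrix.conjTranspose_mul, hRh]
    calc (C⁻¹)ᴴ * R * (R * C⁻¹) = (C⁻¹)ᴴ * (R * R) * C⁻¹ := by simp only [Matrix.mul_assoc]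
      _ = ((C⁻¹)ᴴ * Cᴴ) * (C * C⁻¹) := by rw [hRR]; simp only [Matrix.mul_assoc]
      _ = 1 := by rw [hD, hC1, Matrix.mul_one]
  have hUU' : U * Uᴴ = 1 := mul_eq_one_comm.mp hUU
  have hUC : U * C = R := by rw [hU, Matrix.mul_assoc, hC2, Matrix.mul_one]
  have hCU : C * U = Uᴴ * R * U := by
    rw [← hUC, ← Matrix.mul_assoc, hUU, Matrix.one_mul]
  have hps : (C * U).PosSemidef := by
    rw [hCU]; exact hR.conjTranspose_mul_mul_same U
  have hsq : (C * U) * (C * U) = C * Cᴴ := by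
    have : C * U = (C * U)ᴴ := hps.1.symm
    calc (C * U) * (C * U) = (C * U) * (C * U)ᴴ := by rw [← this]
      _ = C * (U * Uᴴ) * Cᴴ := by
        rw [Matrix.conjTranspose_mul]; simp only [Matrix.mul_assoc]
      _ = C * Cᴴ := by rw [hUU', Matrix.mul_one]
  have hS : matSqrt (1 + ∑ k, matNegPart (E k)) = C * U := by
    rw [← hC]; exact matSqrt_unique hps hsq
  have hinv : (C * U)⁻¹ = Uᴴ * C⁻¹ := by
    apply Matrix.inv_eq_left_inv
    rw [Matrix.mul_assoc, ← Matrix.mul_assoc C⁻¹, hC2, Matrix.one_mul, hUU]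
  have hinv' : (Uᴴ * C⁻¹) = (C⁻¹)ᴴ * U := by
    have h : ((C * U)⁻¹)ᴴ = (C * U)⁻¹ := by
      rw [Matrix.conjTranspose_nonsing_inv, hps.1]
    rw [hinv, Matrix.conjTranspose_mul, Matrix.conjTranspose_conjTranspose] at h
    exact h.symm
  unfold stageTwo
  simp only [hS, hinv]
  calc Uᴴ * (C⁻¹ * matPosPart (E i) * (C⁻¹)ᴴ) * U
      = Uᴴ * C⁻¹ * matPosPart (E i) * ((C⁻¹)ᴴ * U) := by simp only [Matrix.mul_assoc]
    _ = _ := by rw [← hinv']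

end QDT

end

open QDT

open QDT
noncomputable section
namespace QDT

/-! ### Real traces -/

/-! Upper bound. Let `E` project onto the kernel of `P`. Near `P` the infidelity is quadratic in the
error of an estimate `Q`, except for the weight `Tr (Q E)`, which enters to first order
(`exists_infidelity_le`). The two-stage map preserves this structure: if `A` is the unphysical
first-stage estimate, only the block `E (A i - P i) E` contributes linearly, and everything else is
bounded by the squared errors of the `A k` (`exists_infidelity_stageTwo_le`). The squared errors are
of order `1/m` in any basis, so it remains to make the kernel block equally small, although a
generic block has size `1/√m`.

This is what the eigenbasis `b` of the Step 1 estimate achieves. Let `p_k = ⟨b_k|P|b_k⟩` and `x_k =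
‖E b_k‖`. A binomial frequency with success probability `p` has variance at most `p/m`, so the `(k,
l)` matrix element of the error in the basis `b` has second moment at most a constant times `(p_k +
p_l)/m` (`expect_normSq_le`). In the block this element carries the weight `x_k x_l`. An eigenvector
cannot have both `x_k` and `p_k` large: `x_k² p_k` is at most a constant times the squared Step 1
error (`kernel_weight_mul_le`). Weighted AM-GM then bounds the expected block by `1/m` plus the
squared Step 1 error (`expect_kernel_error_le`), and averaging over Step 1 gives `1/N`. Neither the
rank of `P` nor spectral gaps of the estimate have to be known.

Lower bound. On the POVMs with `P_i = p I`, `P_i' = (1 - p) I`, every state yields the same coin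
toss, so adaptivity is useless, and the trace term of the infidelity dominates the squared error of
`Tr Q / d` as an estimate of `p`. A two-point chi-square inequality (`sq_sub_le_coinRisk`) forbids
risk below a small multiple of `1/N` at two biases `1/√N` apart. Baire's theorem turns a pointwise
`o(1/N)` into a uniform bound on an interval, where this applies (`exists_not_isLittleO_coinRisk`).
-/

/-- Real part of the trace. -/
def rtr {d : ℕ} (A : Op d) : ℝ := A.trace.re

section Trace
variable {d : ℕ}

@[simp] theorem rtr_add (A B : Op d) : rtr (A + B) = rtr A + rtr B := by simp [rtr]
@[simp] theorem rtr_sub (A B : Op d) : rtr (A - B) = rtr A - rtr B := by simp [rtr]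
@[simp] theorem rtr_neg (A : Op d) : rtr (-A) = -rtr A := by simp [rtr]
@[simp] theorem rtr_zero : rtr (0 : Op d) = 0 := by simp [rtr]
@[simp] theorem rtr_one : rtr (1 : Op d) = d := by simp [rtr]
@[simp] theorem rtr_smul (c : ℝ) (A : Op d) : rtr (c • A) = c * rtr A := by simp [rtr]
theorem rtr_sum {ι : Type*} (s : Finset ι) (f : ι → Op d) :
    rtr (∑ k ∈ s, f k) = ∑ k ∈ s, rtr (f k) := by simp [rtr, Matrix.trace_sum]
theorem rtr_mul_comm (A B : Op d) : rtr (A * B) = rtr (B * A) := by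
  simp [rtr, Matrix.trace_mul_comm A B]
@[simp] theorem rtr_conjTranspose (A : Op d) : rtr Aᴴ = rtr A := by
  simp [rtr, Matrix.trace_conjTranspose]

theorem rtr_nonneg {A : Op d} (hA : A.PosSemidef) : 0 ≤ rtr A :=
  (Complex.le_def.mp hA.trace_nonneg).1

theorem rtr_mul_nonneg {A B : Op d} (hA : A.PosSemidef) (hB : B.PosSemidef) :
    0 ≤ rtr (A * B) := by
  obtain ⟨hS, hSS⟩ := matSqrt_spec hA
  have h : rtr (A * B) = rtr (matSqrt A * B * (matSqrt A)ᴴ) := by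
    rw [hS.1.eq, rtr_mul_comm _ (matSqrt A), ← Matrix.mul_assoc, hSS]
  rw [h]
  exact rtr_nonneg (hB.mul_mul_conjTranspose_same _)

theorem rtr_pos {A : Op d} (hA : A.PosSemidef) (h0 : A ≠ 0) : 0 < rtr A := by
  refine lt_of_le_of_ne (rtr_nonneg hA) fun h => h0 ?_
  rw [← hA.trace_eq_zero_iff]
  exact Complex.ext h.symm (Complex.le_def.mp hA.trace_nonneg).2.symm

end Trace

/-! ### The Frobenius norm -/

section Norm
open scoped Matrix.Norms.Frobenius

/-- Frobenius norm. -/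
def fnorm {d : ℕ} (A : Op d) : ℝ := ‖A‖

variable {d : ℕ}

theorem fnorm_nonneg (A : Op d) : 0 ≤ fnorm A := norm_nonneg A
theorem eq_zero_of_fnorm_eq_zero {A : Op d} (h : fnorm A = 0) : A = 0 := norm_eq_zero.mp h
theorem fnorm_add_le (A B : Op d) : fnorm (A + B) ≤ fnorm A + fnorm B := norm_add_le A B
theorem fnorm_sub_le (A B : Op d) : fnorm (A - B) ≤ fnorm A + fnorm B := norm_sub_le A B
theorem fnorm_sum_le {ι : Type*} (s : Finset ι) (f : ι → Op d) :
    fnorm (∑ k ∈ s, f k) ≤ ∑ k ∈ s, fnorm (f k) := norm_sum_le s f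
theorem fnorm_mul_le (A B : Op d) : fnorm (A * B) ≤ fnorm A * fnorm B := norm_mul_le A B
@[simp] theorem fnorm_neg (A : Op d) : fnorm (-A) = fnorm A := norm_neg A
@[simp] theorem fnorm_conjTranspose (A : Op d) : fnorm Aᴴ = fnorm A :=
  frobenius_norm_conjTranspose A
theorem fnorm_smul (c : ℂ) (A : Op d) : fnorm (c • A) = ‖c‖ * fnorm A := norm_smul c A
theorem fnorm_real_smul (c : ℝ) (A : Op d) : fnorm (c • A) = |c| * fnorm A := norm_smul c A

theorem fnorm_sq (A : Op d) : fnorm A ^ 2 = rtr (Aᴴ * A) := by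
  unfold fnorm rtr
  rw [frobenius_norm_def, ← Real.sqrt_eq_rpow, Real.sq_sqrt (by positivity)]
  simp only [Matrix.trace, Matrix.diag_apply, Matrix.mul_apply, conjTranspose_apply,
    Complex.re_sum]
  rw [Finset.sum_comm]
  refine Finset.sum_congr rfl fun i _ => Finset.sum_congr rfl fun j _ => ?_
  rw [Real.rpow_two, ← Complex.normSq_eq_norm_sq, Complex.normSq_apply]
  simp

end Norm

/-! ### Cauchy–Schwarz, contractions and orthogonal projections. -/

section NormLemmas
variable {d : ℕ}

theorem frobSq_eq (A : Op d) : frobSq A = fnorm A ^ 2 := (fnorm_sq A).symm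

theorem fnorm_sq_of_isHermitian {A : Op d} (hA : A.IsHermitian) : fnorm A ^ 2 = rtr (A * A) := by
  rw [fnorm_sq, hA.eq]

theorem fnorm_sub_comm (A B : Op d) : fnorm (A - B) = fnorm (B - A) := by
  rw [← fnorm_neg, neg_sub]

theorem fnorm_one_sq : fnorm (1 : Op d) ^ 2 = d := by
  rw [fnorm_sq]; simp

theorem fnorm_add_sq (A B : Op d) :
    fnorm (A + B) ^ 2 = fnorm A ^ 2 + 2 * rtr (Aᴴ * B) + fnorm B ^ 2 := by
  have h : rtr (Bᴴ * A) = rtr (Aᴴ * B) := by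
    rw [← rtr_conjTranspose, conjTranspose_mul, conjTranspose_conjTranspose]
  simp only [fnorm_sq, conjTranspose_add, Matrix.add_mul, Matrix.mul_add, rtr_add, h]
  ring

/-- Cauchy–Schwarz: the quadratic polynomial `t ↦ ‖A + t B‖²` is nonnegative, so its discriminant is
not positive. -/
theorem abs_rtr_conjTranspose_mul_le (A B : Op d) :
    |rtr (Aᴴ * B)| ≤ fnorm A * fnorm B := by
  have h : ∀ t : ℝ, 0 ≤ fnorm B ^ 2 * (t * t) + 2 * rtr (Aᴴ * B) * t + fnorm A ^ 2 := by
    intro t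
    have := fnorm_add_sq A (t • B)
    rw [fnorm_real_smul, Matrix.mul_smul, rtr_smul, mul_pow, sq_abs] at this
    nlinarith [sq_nonneg (fnorm (A + t • B))]
  have h2 := discrim_le_zero h
  unfold discrim at h2
  refine abs_le_of_sq_le_sq ?_ (mul_nonneg (fnorm_nonneg _) (fnorm_nonneg _))
  nlinarith

theorem abs_rtr_mul_le (A B : Op d) : |rtr (A * B)| ≤ fnorm A * fnorm B := by
  have := abs_rtr_conjTranspose_mul_le Aᴴ B
  rwa [conjTranspose_conjTranspose, fnorm_conjTranspose] at this

theorem rtr_mul_le (A B : Op d) : rtr (A * B) ≤ fnorm A * fnorm B :=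
  (le_abs_self _).trans (abs_rtr_mul_le A B)

/-- A matrix `W` with `W†W ≤ 1` does not increase the Frobenius norm. -/
theorem fnorm_mul_le_of_contraction {W : Op d} (hW : (1 - Wᴴ * W).PosSemidef) (A : Op d) :
    fnorm (W * A) ≤ fnorm A := by
  refine abs_le_of_sq_le_sq' ?_ (fnorm_nonneg _) |>.2
  have h := rtr_mul_nonneg hW (posSemidef_self_mul_conjTranspose A)
  have e1 : rtr ((Wᴴ * W) * (A * Aᴴ)) = fnorm (W * A) ^ 2 := by
    rw [fnorm_sq, conjTranspose_mul]
    rw [show Aᴴ * Wᴴ * (W * A) = Aᴴ * (Wᴴ * W * A) by simp only [Matrix.mul_assoc],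
      rtr_mul_comm Aᴴ]
    simp only [Matrix.mul_assoc]
  rw [Matrix.sub_mul, Matrix.one_mul, rtr_sub, e1, rtr_mul_comm, ← fnorm_sq] at h
  linarith

theorem conjTranspose_mul_self_eq_zero' {A : Op d} (h : Aᴴ * A = 0) : A = 0 :=
  Matrix.conjTranspose_mul_self_eq_zero.mp h

/-- An orthogonal projection. -/
structure IsProj (E : Op d) : Prop where
  isHermitian : E.IsHermitian
  idem : E * E = E

theorem IsProj.posSemidef {E : Op d} (hE : IsProj E) : E.PosSemidef := by
  have := posSemidef_conjTranspose_mul_self E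
  rwa [hE.isHermitian.eq, hE.idem] at this

theorem IsProj.compl {E : Op d} (hE : IsProj E) : IsProj (1 - E) := by
  refine ⟨isHermitian_one.sub hE.isHermitian, ?_⟩
  rw [Matrix.mul_sub, Matrix.sub_mul, Matrix.sub_mul, hE.idem]
  simp

theorem IsProj.fnorm_mul_le {E : Op d} (hE : IsProj E) (A : Op d) : fnorm (E * A) ≤ fnorm A := by
  apply fnorm_mul_le_of_contraction
  rw [hE.isHermitian.eq, hE.idem]
  exact hE.compl.posSemidef

theorem IsProj.fnorm_mul_le' {E : Op d} (hE : IsProj E) (A : Op d) : fnorm (A * E) ≤ fnorm A := by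
  rw [← fnorm_conjTranspose (A * E), conjTranspose_mul, hE.isHermitian.eq, ← fnorm_conjTranspose A]
  exact hE.fnorm_mul_le _

theorem IsProj.fnorm_sq_mul {E : Op d} (hE : IsProj E) (A : Op d) :
    fnorm (A * E) ^ 2 = rtr (Aᴴ * A * E) := by
  rw [fnorm_sq, conjTranspose_mul, hE.isHermitian.eq, Matrix.mul_assoc, rtr_mul_comm]
  simp only [Matrix.mul_assoc, hE.idem]

/-! ### Functional calculus -/

/-- The spectrum is finite, so indicators and `x⁻¹` are legitimate in the functional calculus. -/
theorem continuousOn_spectrum (f : ℝ → ℝ) (A : Op d) : ContinuousOn f (spectrum ℝ A) :=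
  (Matrix.finite_real_spectrum (A := A)).continuousOn _

theorem cfc_isHermitian (f : ℝ → ℝ) (A : Op d) : (cfc f A).IsHermitian :=
  IsSelfAdjoint.cfc

theorem cfc_mul' (f g : ℝ → ℝ) (A : Op d) : cfc f A * cfc g A = cfc (fun x => f x * g x) A :=
  (cfc_mul f g A (continuousOn_spectrum f A) (continuousOn_spectrum g A)).symm

theorem cfc_sub' (f g : ℝ → ℝ) (A : Op d) : cfc f A - cfc g A = cfc (fun x => f x - g x) A :=
  (cfc_sub f g A (continuousOn_spectrum f A) (continuousOn_spectrum g A)).symm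

theorem cfc_self {A : Op d} (hA : A.IsHermitian) : cfc (fun x : ℝ => x) A = A :=
  cfc_id' ℝ A (ha := hA)

theorem spectrum_nonneg {A : Op d} (hA : A.PosSemidef) {x : ℝ} (hx : x ∈ spectrum ℝ A) :
    0 ≤ x := by
  rw [hA.1.spectrum_real_eq_range_eigenvalues] at hx
  obtain ⟨k, rfl⟩ := hx
  exact hA.eigenvalues_nonneg k

theorem posPart_sub_negPart {A : Op d} (hA : A.IsHermitian) :
    matPosPart A - matNegPart A = A := by
  unfold matPosPart matNegPart
  rw [cfc_sub']
  conv_rhs => rw [← cfc_self hA]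
  refine cfc_congr fun x _ => ?_
  rcases le_total x 0 with h | h <;> simp [h]

theorem posPart_posSemidef (A : Op d) : (matPosPart A).PosSemidef :=
  cfc_posSemidef _ _ fun _ _ => le_max_right _ _

theorem negPart_posSemidef (A : Op d) : (matNegPart A).PosSemidef :=
  cfc_posSemidef _ _ fun _ _ => le_max_right _ _

theorem posPart_mul_negPart (A : Op d) : matPosPart A * matNegPart A = 0 := by
  unfold matPosPart matNegPart
  rw [cfc_mul', ← cfc_zero ℝ A]
  refine cfc_congr fun x _ => ?_
  rcases le_total x 0 with h | h <;> simp [h]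

/-- The spectral projection onto the negative part. -/
theorem exists_proj_negPart {A : Op d} (hA : A.IsHermitian) :
    ∃ R : Op d, IsProj R ∧ R * A = -matNegPart A := by
  refine ⟨cfc (fun x : ℝ => if x < 0 then 1 else 0) A, ⟨cfc_isHermitian _ _, ?_⟩, ?_⟩
  · rw [cfc_mul']
    exact cfc_congr fun x _ => by by_cases h : x < 0 <;> simp [h]
  · conv_lhs => rw [← cfc_self hA]
    unfold matNegPart
    have h1 := cfc_self hA
    rw [h1]
    nth_rw 2 [← h1]
    rw [cfc_mul', ← cfc_neg]
    refine cfc_congr fun x _ => ?_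
    by_cases h : x < 0
    · simp [h, le_of_lt h]
    · simp [h, not_lt.mp h]

/-- A positive semidefinite matrix dominates a multiple of the projection onto its support. -/
theorem exists_kernel_proj {A : Op d} (hA : A.PosSemidef) :
    ∃ (E : Op d) (c : ℝ), IsProj E ∧ A * E = 0 ∧ 0 < c ∧ (A - c • (1 - E)).PosSemidef ∧
      (A * A - c • A).PosSemidef := by
  have hfin := Matrix.finite_real_spectrum (A := A)
  -- `c` is the smallest nonzero eigenvalue, or `1` if there is none.
  obtain ⟨c, hc, hcx⟩ : ∃ c : ℝ, 0 < c ∧ ∀ x ∈ spectrum ℝ A, x ≠ 0 → c ≤ x := by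
    rcases (hfin.toFinset.filter fun x => x ≠ 0).eq_empty_or_nonempty with h | h
    · refine ⟨1, one_pos, fun x hx h0 => ?_⟩
      have : x ∈ hfin.toFinset.filter fun x => x ≠ 0 := by simp [hx, h0]
      rw [h] at this
      simp at this
    · refine ⟨(hfin.toFinset.filter fun x => x ≠ 0).min' h, ?_, fun x hx h0 =>
        Finset.min'_le _ _ (by simp [hx, h0])⟩
      have := Finset.min'_mem _ h
      simp only [Finset.mem_filter, Set.Finite.mem_toFinset] at this
      exact lt_of_le_of_ne (spectrum_nonneg hA this.1) (Ne.symm this.2)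
  refine ⟨cfc (fun x : ℝ => if x = 0 then 1 else 0) A, c, ⟨cfc_isHermitian _ _, ?_⟩, ?_, hc, ?_, ?_⟩
  · rw [cfc_mul']
    exact cfc_congr fun x _ => by by_cases h : x = 0 <;> simp [h]
  · nth_rw 1 [← cfc_self hA.1]
    rw [cfc_mul', ← cfc_zero ℝ A]
    exact cfc_congr fun x _ => by by_cases h : x = 0 <;> simp [h]
  · have e : A - c • (1 - cfc (fun x : ℝ => if x = 0 then 1 else 0) A)
        = cfc (fun x : ℝ => x - c * (1 - if x = 0 then 1 else 0)) A := by
      have h1 : (1 : Op d) = cfc (fun _ : ℝ => (1 : ℝ)) A := (cfc_const_one ℝ A (ha := hA.1)).symm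
      rw [← cfc_sub', cfc_self hA.1]
      rw [cfc_const_mul c _ A (continuousOn_spectrum _ A), ← cfc_sub', ← h1]
    rw [e]
    refine cfc_posSemidef _ _ fun x hx => ?_
    by_cases h : x = 0
    · simp [h]
    · simpa [h] using hcx x hx h
  · have e : A * A - c • A = cfc (fun x : ℝ => x * x - c * x) A := by
      rw [← cfc_sub', ← cfc_mul', cfc_self hA.1, cfc_const_mul c _ A (continuousOn_spectrum _ A),
        cfc_self hA.1]
    rw [e]
    refine cfc_posSemidef _ _ fun x hx => ?_
    by_cases h : x = 0
    · simp [h]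
    · have h1 := hcx x hx h
      nlinarith

end NormLemmas

/-! ### Polar decomposition and fidelity -/

section Fidelity
variable {d : ℕ}

/-- Here `W = M B` with `B` the pseudo-inverse of `A`, which the functional calculus provides
because `0⁻¹ = 0`. It is a partial isometry: `W†W` and `WW†` are both projections. -/
theorem exists_polar (M : Op d) {A : Op d} (hA : A.PosSemidef) (h : A * A = Mᴴ * M) :
    ∃ W : Op d, M = W * A ∧ Wᴴ * M = A ∧ (1 - Wᴴ * W).PosSemidef ∧
      (1 - W * Wᴴ).PosSemidef := by
  have h1 := cfc_self hA.1
  obtain ⟨B, hB, hAB, hBA, hcomm⟩ : ∃ B : Op d, B.IsHermitian ∧ A * B * A = A ∧ B * A * B = B ∧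
      A * B = B * A := by
    refine ⟨cfc (fun x : ℝ => x⁻¹) A, cfc_isHermitian _ _, ?_, ?_, ?_⟩
    · suffices cfc (fun x : ℝ => x) A * cfc (fun x : ℝ => x⁻¹) A * cfc (fun x : ℝ => x) A
          = cfc (fun x : ℝ => x) A by rwa [h1] at this
      rw [cfc_mul', cfc_mul']
      exact cfc_congr fun x _ => mul_inv_mul_cancel x
    · suffices cfc (fun x : ℝ => x⁻¹) A * cfc (fun x : ℝ => x) A * cfc (fun x : ℝ => x⁻¹) A
          = cfc (fun x : ℝ => x⁻¹) A by rwa [h1] at this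
      rw [cfc_mul', cfc_mul']
      refine cfc_congr fun x _ => ?_
      by_cases hx : x = 0
      · simp [hx]
      · field_simp
    · suffices cfc (fun x : ℝ => x) A * cfc (fun x : ℝ => x⁻¹) A
          = cfc (fun x : ℝ => x⁻¹) A * cfc (fun x : ℝ => x) A by rwa [h1] at this
      rw [cfc_mul', cfc_mul']
      exact cfc_congr fun x _ => mul_comm _ _
  have hA' := hA.1.eq
  have hWW : (M * B)ᴴ * (M * B) = B * A := by
    rw [conjTranspose_mul, hB.eq]
    calc B * Mᴴ * (M * B) = B * (Mᴴ * M) * B := by simp only [Matrix.mul_assoc]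
      _ = B * A * (A * B) := by rw [← h]; simp only [Matrix.mul_assoc]
      _ = (B * A * B) * A := by rw [hcomm]; simp only [Matrix.mul_assoc]
      _ = B * A := by rw [hBA]
  have hMA : M * (1 - B * A) = 0 := by
    apply conjTranspose_mul_self_eq_zero'
    rw [conjTranspose_mul]
    calc (1 - B * A)ᴴ * Mᴴ * (M * (1 - B * A)) = (1 - B * A)ᴴ * ((Mᴴ * M) * (1 - B * A)) := by
          simp only [Matrix.mul_assoc]
      _ = (1 - B * A)ᴴ * (A * (A - A * B * A)) := by
          rw [← h]; simp only [Matrix.mul_assoc, Matrix.mul_sub, Matrix.mul_one]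
      _ = 0 := by rw [hAB]; simp
  have hP : IsProj (B * A) := by
    refine ⟨?_, ?_⟩
    · rw [IsHermitian, conjTranspose_mul, hA', hB.eq, hcomm]
    · rw [← Matrix.mul_assoc, hBA]
  refine ⟨M * B, ?_, ?_, ?_, ?_⟩
  · rw [Matrix.mul_sub, Matrix.mul_one, sub_eq_zero] at hMA
    rw [Matrix.mul_assoc]; exact hMA
  · rw [conjTranspose_mul, hB.eq, Matrix.mul_assoc, ← h, ← Matrix.mul_assoc, ← hcomm, hAB]
  · rw [hWW]; exact hP.compl.posSemidef
  · refine IsProj.posSemidef (IsProj.compl ⟨isHermitian_mul_conjTranspose_self _, ?_⟩)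
    calc M * B * (M * B)ᴴ * (M * B * (M * B)ᴴ) = M * B * ((M * B)ᴴ * (M * B)) * (M * B)ᴴ := by
          simp only [Matrix.mul_assoc]
      _ = M * (B * (B * A)) * (M * B)ᴴ := by rw [hWW]; simp only [Matrix.mul_assoc]
      _ = M * B * (M * B)ᴴ := by rw [← hcomm, ← Matrix.mul_assoc B, hBA]

/-- With `M = W A` and `V = √A`, the trace of `M` is that of `V (W V)`. Cauchy–Schwarz and the
contraction `W` bound it by `‖V‖² = Tr A`. -/
theorem rtr_le_of_sq_eq (M : Op d) {A : Op d} (hA : A.PosSemidef) (h : A * A = Mᴴ * M) :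
    rtr M ≤ rtr A := by
  obtain ⟨W, hM, -, hW, -⟩ := exists_polar M hA h
  obtain ⟨hV, hVV⟩ := matSqrt_spec hA
  set V := matSqrt A
  have e : rtr M = rtr (V * (W * V)) := by
    rw [rtr_mul_comm, Matrix.mul_assoc, hVV, ← hM]
  have e2 : rtr A = fnorm V * fnorm V := by
    rw [← sq, fnorm_sq_of_isHermitian hV.1, hVV]
  rw [e, e2]
  exact (rtr_mul_le _ _).trans
    (mul_le_mul_of_nonneg_left (fnorm_mul_le_of_contraction hW V) (fnorm_nonneg _))

theorem sqrt_mul_conj {P Q : Op d} (hP : P.PosSemidef) (hQ : Q.PosSemidef) :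
    (matSqrt P * matSqrt Q)ᴴ * (matSqrt P * matSqrt Q) = matSqrt Q * P * matSqrt Q := by
  obtain ⟨hR, hRR⟩ := matSqrt_spec hP
  obtain ⟨hT, hTT⟩ := matSqrt_spec hQ
  rw [conjTranspose_mul, hR.1.eq, hT.1.eq]
  calc matSqrt Q * matSqrt P * (matSqrt P * matSqrt Q)
      = matSqrt Q * (matSqrt P * matSqrt P) * matSqrt Q := by simp only [Matrix.mul_assoc]
    _ = _ := by rw [hRR]

theorem fidelity_sqrt_spec {P Q : Op d} (hP : P.PosSemidef) (hQ : Q.PosSemidef) :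
    (matSqrt (matSqrt Q * P * matSqrt Q)).PosSemidef ∧
    matSqrt (matSqrt Q * P * matSqrt Q) * matSqrt (matSqrt Q * P * matSqrt Q) =
      (matSqrt P * matSqrt Q)ᴴ * (matSqrt P * matSqrt Q) := by
  have h : (matSqrt Q * P * matSqrt Q).PosSemidef := by
    rw [← sqrt_mul_conj hP hQ]; exact posSemidef_conjTranspose_mul_self _
  refine ⟨(matSqrt_spec h).1, ?_⟩
  rw [(matSqrt_spec h).2, sqrt_mul_conj hP hQ]

/-- `Tr √(√Q P √Q) ≥ Re Tr (√P √Q)`. -/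
theorem rtr_sqrt_mul_sqrt_le {P Q : Op d} (hP : P.PosSemidef) (hQ : Q.PosSemidef) :
    rtr (matSqrt P * matSqrt Q) ≤ rtr (matSqrt (matSqrt Q * P * matSqrt Q)) :=
  rtr_le_of_sq_eq _ (fidelity_sqrt_spec hP hQ).1 (fidelity_sqrt_spec hP hQ).2

/-- `(Tr √(√Q P √Q))² ≤ Tr P Tr Q`. -/
theorem sq_rtr_fidelity_le {P Q : Op d} (hP : P.PosSemidef) (hQ : Q.PosSemidef) :
    rtr (matSqrt (matSqrt Q * P * matSqrt Q)) ^ 2 ≤ rtr P * rtr Q := by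
  obtain ⟨h1, h2⟩ := fidelity_sqrt_spec hP hQ
  obtain ⟨hR, hRR⟩ := matSqrt_spec hP
  obtain ⟨hT, hTT⟩ := matSqrt_spec hQ
  obtain ⟨W, -, hW, -, hWW⟩ := exists_polar _ h1 h2
  set A := matSqrt (matSqrt Q * P * matSqrt Q)
  -- The polar factor exhibits the trace as an inner product of two vectors of squared norms at most
  -- `Tr P` and `Tr Q`.
  have e : rtr A = rtr ((Wᴴ * matSqrt P) * matSqrt Q) := by rw [← hW, Matrix.mul_assoc]
  have hle : rtr A ≤ fnorm (matSqrt P) * fnorm (matSqrt Q) := by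
    rw [e]
    refine (rtr_mul_le _ _).trans (mul_le_mul_of_nonneg_right ?_ (fnorm_nonneg _))
    exact fnorm_mul_le_of_contraction (by rwa [conjTranspose_conjTranspose]) _
  calc rtr A ^ 2 ≤ (fnorm (matSqrt P) * fnorm (matSqrt Q)) ^ 2 := by
        gcongr; exact rtr_nonneg h1
    _ = rtr P * rtr Q := by
        rw [mul_pow, fnorm_sq_of_isHermitian hR.1, fnorm_sq_of_isHermitian hT.1, hRR, hTT]

theorem infidelity_eq (Q P : Op d) : infidelity Q P =
    1 - rtr (matSqrt (matSqrt Q * P * matSqrt Q)) ^ 2 / (rtr P * rtr Q)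
      + rtr (P - Q) ^ 2 / (d : ℝ) ^ 2 := by
  unfold infidelity fidelity rtr; ring

/-- The quotient in the fidelity never exceeds `1`, also when its denominator is `0`. The surviving
trace term is all that the lower bound on the rate needs. -/
theorem le_infidelity {P Q : Op d} (hP : P.PosSemidef) (hQ : Q.PosSemidef) :
    rtr (P - Q) ^ 2 / (d : ℝ) ^ 2 ≤ infidelity Q P := by
  rw [infidelity_eq]
  have h : rtr (matSqrt (matSqrt Q * P * matSqrt Q)) ^ 2 / (rtr P * rtr Q) ≤ 1 :=
    div_le_one_of_le₀ (sq_rtr_fidelity_le hP hQ) (mul_nonneg (rtr_nonneg hP) (rtr_nonneg hQ))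
  linarith

theorem infidelity_nonneg {P Q : Op d} (hP : P.PosSemidef) (hQ : Q.PosSemidef) :
    0 ≤ infidelity Q P :=
  le_trans (by positivity) (le_infidelity hP hQ)

end Fidelity

/-! ### Upper bounds for the infidelity near the true element. -/

section FidelityBound
variable {d : ℕ}

theorem sq_rtr_le (A : Op d) : rtr A ^ 2 ≤ d * fnorm A ^ 2 := by
  have h := abs_rtr_mul_le 1 A
  rw [Matrix.one_mul] at h
  calc rtr A ^ 2 = |rtr A| ^ 2 := (sq_abs _).symm
    _ ≤ (fnorm (1 : Op d) * fnorm A) ^ 2 := by gcongr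
    _ = _ := by rw [mul_pow, fnorm_one_sq]

theorem fnorm_one_le : fnorm (1 : Op d) ≤ d := by
  refine abs_le_of_sq_le_sq' ?_ (Nat.cast_nonneg d) |>.2
  rw [fnorm_one_sq]
  exact_mod_cast Nat.le_self_pow two_ne_zero d

theorem rtr_le (A : Op d) : rtr A ≤ d * fnorm A := by
  have h := rtr_mul_le 1 A
  rw [Matrix.one_mul] at h
  exact h.trans (mul_le_mul_of_nonneg_right fnorm_one_le (fnorm_nonneg _))

theorem IsProj.fnorm_le {E : Op d} (hE : IsProj E) : fnorm E ≤ d := by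
  have := hE.fnorm_mul_le 1
  rw [Matrix.mul_one] at this
  exact this.trans fnorm_one_le

/-- Distance of the square roots, up to the weight of `Q` on the kernel of `P`. -/
theorem fnorm_sqrt_sub_sqrt_sq_le {P Q E : Op d} {c : ℝ} (hP : P.PosSemidef) (hQ : Q.PosSemidef)
    (hE : IsProj E) (hPE : P * E = 0) (hc : 0 < c) (hcE : (P - c • (1 - E)).PosSemidef) :
    fnorm (matSqrt Q - matSqrt P) ^ 2 ≤ fnorm (P - Q) ^ 2 / c + rtr (Q * E) := by
  obtain ⟨hR, hRR⟩ := matSqrt_spec hP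
  obtain ⟨hT, hTT⟩ := matSqrt_spec hQ
  set R := matSqrt P
  set T := matSqrt Q
  have hD : (T - R).IsHermitian := hT.1.sub hR.1
  have hRE : R * E = 0 := by
    apply conjTranspose_mul_self_eq_zero'
    rw [conjTranspose_mul, hR.1.eq, Matrix.mul_assoc, ← Matrix.mul_assoc R, hRR, hPE,
      Matrix.mul_zero]
  -- In `Q - P = (T - R) R + T (T - R)` the two terms have inner product `Tr R (T - R) T (T - R) ≥
  -- 0`, so dropping the second does not increase the norm.
  have h1 : fnorm ((T - R) * R) ^ 2 ≤ fnorm (P - Q) ^ 2 := by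
    have e : Q - P = (T - R) * R + T * (T - R) := by
      rw [Matrix.sub_mul, Matrix.mul_sub, hTT, hRR]; abel
    have h := rtr_mul_nonneg hR (hT.mul_mul_conjTranspose_same (T - R))
    rw [hD.eq] at h
    have e2 : rtr (((T - R) * R)ᴴ * (T * (T - R))) = rtr (R * ((T - R) * T * (T - R))) := by
      rw [conjTranspose_mul, hD.eq, hR.1.eq]; simp only [Matrix.mul_assoc]
    rw [fnorm_sub_comm, e, fnorm_add_sq, e2]
    nlinarith [sq_nonneg (fnorm (T * (T - R)))]
  have h2 : fnorm ((T - R) * R) ^ 2 = rtr ((T - R) * (T - R) * P) := by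
    rw [fnorm_sq, conjTranspose_mul, hD.eq, hR.1.eq, ← hRR, rtr_mul_comm]
    rw [Matrix.mul_assoc, ← Matrix.mul_assoc R R, rtr_mul_comm, Matrix.mul_assoc, rtr_mul_comm]
  have h3 : 0 ≤ rtr ((T - R) * (T - R) * (P - c • (1 - E))) := by
    have := posSemidef_conjTranspose_mul_self (T - R)
    rw [hD.eq] at this
    exact rtr_mul_nonneg this hcE
  -- On the kernel of `P` the root `R` vanishes. Off the kernel, `P ≥ c (1 - E)` in `h3` converts
  -- the bound on `(T - R) R` into one on `T - R`.
  have h4 : fnorm ((T - R) * E) ^ 2 = rtr (Q * E) := by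
    rw [Matrix.sub_mul, hRE, sub_zero, hE.fnorm_sq_mul, hT.1.eq, hTT]
  have h5 := hE.fnorm_sq_mul (T - R)
  rw [hD.eq] at h5
  have h6 := fnorm_sq_of_isHermitian hD
  rw [Matrix.mul_sub _ P, rtr_sub, Matrix.mul_smul, rtr_smul, Matrix.mul_sub _ 1, Matrix.mul_one,
    rtr_sub] at h3
  rw [h6]
  have h7 : rtr ((T - R) * (T - R)) - rtr (Q * E) ≤ fnorm (P - Q) ^ 2 / c := by
    rw [le_div_iff₀ hc]
    nlinarith
  linarith

/-- Scalar part of `exists_infidelity_le`: `a`, `b` are the traces of `P`, `Q`, `f` is the trace in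
the fidelity, `e` the squared distance of the roots, `x` the squared error and `y` the kernel
weight. If `b < a / 2`, the error is so large that the right side exceeds `1`. Otherwise `1 -
f²/(ab) ≤ (a + b) e / (2ab) ≤ 3e / (2a)`. -/
theorem one_sub_sq_div_le {a b c d e f x y : ℝ} (hd : 1 ≤ d) (ha : 0 < a) (hb : 0 ≤ b)
    (he : 0 ≤ e) (hy : 0 ≤ y) (h : a + b - e ≤ 2 * f) (hx : e ≤ x / c + y)
    (hab : (a - b) ^ 2 ≤ d * x) (hc : 0 < c) :
    1 - f ^ 2 / (a * b) + (a - b) ^ 2 / d ^ 2 ≤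
      (3 / (2 * a) * (1 / c + 1) + 4 * d / a ^ 2 + 1) * (x + y) := by
  have hx0 : 0 ≤ x := by
    by_contra hneg
    nlinarith [sq_nonneg (a - b)]
  have hlast : (a - b) ^ 2 / d ^ 2 ≤ x := by
    rw [div_le_iff₀ (by positivity)]
    calc (a - b) ^ 2 ≤ d * x := hab
      _ ≤ x * d ^ 2 := by nlinarith [mul_nonneg hx0 (by linarith : (0 : ℝ) ≤ d)]
  have h3 : 0 ≤ 3 / (2 * a) * (1 / c + 1) * (x + y) := by positivity
  have h4 : 0 ≤ 4 * d / a ^ 2 * y := by positivity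
  have h5 : 0 ≤ 4 * d / a ^ 2 * x := by positivity
  have hfirst : 1 - f ^ 2 / (a * b)
      ≤ 3 / (2 * a) * (1 / c + 1) * (x + y) + 4 * d / a ^ 2 * x := by
    rcases lt_or_ge b (a / 2) with h' | h'
    · have h1 : 0 ≤ f ^ 2 / (a * b) := by positivity
      have h2 : 1 ≤ 4 * d / a ^ 2 * x := by
        rw [div_mul_eq_mul_div, le_div_iff₀ (by positivity)]
        nlinarith
      linarith
    · have hb' : 0 < b := by linarith
      have hf2 : a * b - (a + b) * e / 2 ≤ f ^ 2 := by
        rcases le_total (a + b) e with h'' | h''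
        · nlinarith [sq_nonneg f, sq_nonneg (a - b),
            mul_le_mul_of_nonneg_left h'' (by linarith : 0 ≤ a + b)]
        · have h2 : ((a + b - e) / 2) ^ 2 ≤ f ^ 2 :=
            pow_le_pow_left₀ (by linarith) (by linarith) 2
          nlinarith [sq_nonneg (a - b), sq_nonneg e]
      have h1 : 1 - f ^ 2 / (a * b) ≤ 3 / (2 * a) * e := by
        have : 1 - f ^ 2 / (a * b) = (a * b - f ^ 2) / (a * b) := by field_simp
        rw [this, div_mul_eq_mul_div, div_le_div_iff₀ (by positivity) (by positivity)]
        have h6 : a * b - f ^ 2 ≤ (a + b) * e / 2 := by linarith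
        calc (a * b - f ^ 2) * (2 * a) ≤ ((a + b) * e / 2) * (2 * a) := by gcongr
          _ ≤ 3 * e * (a * b) := by
            nlinarith [mul_nonneg he (mul_nonneg ha.le (by linarith : 0 ≤ 2 * b - a))]
      have h2 : e ≤ (1 / c + 1) * (x + y) := by
        have h3 : x / c = 1 / c * x := by ring
        have h4 : 0 ≤ 1 / c * y := by positivity
        nlinarith
      have h3 : 3 / (2 * a) * e ≤ 3 / (2 * a) * ((1 / c + 1) * (x + y)) := by gcongr
      linarith
  linarith

/-- The infidelity is quadratic in the error, except for the weight of the estimate on the kernel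
of the true operator. -/
theorem exists_infidelity_le {P E : Op d} {c : ℝ} (hd : 1 ≤ d) (hP : P.PosSemidef) (h0 : P ≠ 0)
    (hE : IsProj E) (hPE : P * E = 0) (hc : 0 < c) (hcE : (P - c • (1 - E)).PosSemidef) :
    ∃ C : ℝ, 0 ≤ C ∧ ∀ Q : Op d, Q.PosSemidef →
      infidelity Q P ≤ C * (fnorm (P - Q) ^ 2 + rtr (Q * E)) := by
  have ha := rtr_pos hP h0
  set a := rtr P with ha_def
  have hd' : (1 : ℝ) ≤ d := by exact_mod_cast hd
  refine ⟨3 / (2 * a) * (1 / c + 1) + 4 * d / a ^ 2 + 1, by positivity, fun Q hQ => ?_⟩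
  have hsq := fnorm_sqrt_sub_sqrt_sq_le hP hQ hE hPE hc hcE
  have hQE : 0 ≤ rtr (Q * E) := rtr_mul_nonneg hQ hE.posSemidef
  have hb := rtr_nonneg hQ
  have hf := rtr_sqrt_mul_sqrt_le hP hQ
  have hab := sq_rtr_le (P - Q)
  rw [infidelity_eq]
  set f := rtr (matSqrt (matSqrt Q * P * matSqrt Q))
  have he : fnorm (matSqrt Q - matSqrt P) ^ 2
      = a + rtr Q - 2 * rtr (matSqrt P * matSqrt Q) := by
    obtain ⟨hR, hRR⟩ := matSqrt_spec hP
    obtain ⟨hT, hTT⟩ := matSqrt_spec hQ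
    rw [fnorm_sq_of_isHermitian (hT.1.sub hR.1), Matrix.mul_sub, Matrix.sub_mul, Matrix.sub_mul,
      hRR, hTT, rtr_sub, rtr_sub, rtr_sub, rtr_mul_comm (matSqrt Q)]
    ring
  set e := fnorm (matSqrt Q - matSqrt P) ^ 2 with he_def
  have he0 : 0 ≤ e := sq_nonneg _
  set b := rtr Q
  set x := fnorm (P - Q) ^ 2
  have hx : 0 ≤ x := sq_nonneg _
  set y := rtr (Q * E)
  rw [rtr_sub] at hab ⊢
  exact one_sub_sq_div_le hd' ha hb he0 hQE (by linarith) hsq hab hc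

end FidelityBound

/-! ### Perturbation bounds for the second stage. -/

section StageTwo
variable {d n : ℕ}

/-- Write `F`, `G` for the positive and negative parts. In `A - P = (F - P) - G` the cross term is
`2 Tr (P G) ≥ 0`, because `F G = 0`. -/
theorem fnorm_parts_sq_le {A P : Op d} (hA : A.IsHermitian) (hP : P.PosSemidef) :
    fnorm (matPosPart A - P) ^ 2 + fnorm (matNegPart A) ^ 2 ≤ fnorm (A - P) ^ 2 := by
  have hF := posPart_posSemidef A
  have hG := negPart_posSemidef A
  have e : A - P = (matPosPart A - P) + -matNegPart A := by
    nth_rw 1 [← posPart_sub_negPart hA]; abel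
  have h := rtr_mul_nonneg hP hG
  have e2 : rtr ((matPosPart A - P)ᴴ * -matNegPart A) = rtr (P * matNegPart A) := by
    rw [(hF.1.sub hP.1).eq, Matrix.mul_neg, Matrix.sub_mul, posPart_mul_negPart]
    simp
  rw [e, fnorm_add_sq, e2, fnorm_neg]
  linarith

theorem fnorm_negPart_le {A P : Op d} (hA : A.IsHermitian) (hP : P.PosSemidef) :
    fnorm (matNegPart A) ≤ fnorm (A - P) := by
  refine abs_le_of_sq_le_sq' ?_ (fnorm_nonneg _) |>.2
  nlinarith [fnorm_parts_sq_le hA hP, sq_nonneg (fnorm (matPosPart A - P))]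

theorem fnorm_posPart_sub_le {A P : Op d} (hA : A.IsHermitian) (hP : P.PosSemidef) :
    fnorm (matPosPart A - P) ≤ fnorm (A - P) := by
  refine abs_le_of_sq_le_sq' ?_ (fnorm_nonneg _) |>.2
  nlinarith [fnorm_parts_sq_le hA hP, sq_nonneg (fnorm (matNegPart A))]

/-- The trace of the negative part of a perturbation of `P` is quadratic in the perturbation,
except for the block of the perturbation on the kernel of `P`. -/
theorem rtr_negPart_le {A P E : Op d} {c : ℝ} (hA : A.IsHermitian)
    (hE : IsProj E) (hc : 0 < c) (hcE : (P - c • (1 - E)).PosSemidef) :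
    rtr (matNegPart A) ≤ fnorm (A - P) ^ 2 / c + d * fnorm (E * (A - P) * E) := by
  obtain ⟨R, hR, hRA⟩ := exists_proj_negPart hA
  set D := A - P with hD
  have hs := hE.compl.fnorm_sq_mul R
  rw [hR.isHermitian.eq, hR.idem] at hs
  set s := fnorm (R * (1 - E))
  have h1 : rtr (matNegPart A) = -rtr (R * P) - rtr (R * D) := by
    have : matNegPart A = -(R * A) := by rw [hRA, neg_neg]
    rw [this, rtr_neg, hD, Matrix.mul_sub, rtr_sub]; ring
  have h2 : c * s ^ 2 ≤ rtr (R * P) := by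
    have h := rtr_mul_nonneg hR.posSemidef hcE
    rw [Matrix.mul_sub, Matrix.mul_smul, rtr_sub, rtr_smul, ← hs] at h
    linarith
  have e : rtr (R * D) = rtr (R * (E * D * E)) + rtr (((1 - E) * R) * D)
      + rtr ((E * (R * (1 - E))) * D) := by
    have e1 : R * D = ((1 - E) * R) * D + (E * (R * (1 - E))) * D + E * (R * E * D) := by
      simp only [Matrix.sub_mul, Matrix.mul_sub, Matrix.one_mul, Matrix.mul_one, Matrix.mul_assoc]
      abel
    have e2 : rtr (E * (R * E * D)) = rtr (R * (E * D * E)) := by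
      rw [rtr_mul_comm]; simp only [Matrix.mul_assoc]
    rw [e1, rtr_add, rtr_add, e2]; ring
  have b1 : -(d * fnorm (E * D * E)) ≤ rtr (R * (E * D * E)) := by
    have := (abs_le.mp (abs_rtr_mul_le R (E * D * E))).1
    have h' := mul_le_mul_of_nonneg_right hR.fnorm_le (fnorm_nonneg (E * D * E))
    linarith
  have b2 : -(s * fnorm D) ≤ rtr (((1 - E) * R) * D) := by
    have := (abs_le.mp (abs_rtr_mul_le ((1 - E) * R) D)).1
    have e3 : fnorm ((1 - E) * R) = s := by
      rw [← fnorm_conjTranspose, conjTranspose_mul, hR.isHermitian.eq,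
        hE.compl.isHermitian.eq]
    rwa [e3] at this
  have b3 : -(s * fnorm D) ≤ rtr ((E * (R * (1 - E))) * D) := by
    have := (abs_le.mp (abs_rtr_mul_le (E * (R * (1 - E))) D)).1
    have h' := mul_le_mul_of_nonneg_right (hE.fnorm_mul_le (R * (1 - E))) (fnorm_nonneg D)
    linarith
  -- The gain `c s²` from the positivity of `P` on its support absorbs the first-order loss `2 s
  -- ‖D‖`, leaving a quadratic remainder.
  have h3 : 2 * s * fnorm D - c * s ^ 2 ≤ fnorm D ^ 2 / c := by
    rw [le_div_iff₀ hc]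
    nlinarith [sq_nonneg (fnorm D - c * s)]
  linarith

/-- The inverse square root of `1 + H`. -/
theorem inv_sqrt_one_add {H : Op d} (hH : H.PosSemidef) :
    ((matSqrt (1 + H))⁻¹).PosSemidef ∧ fnorm (matSqrt (1 + H))⁻¹ ≤ d ∧
      fnorm (1 - (matSqrt (1 + H))⁻¹) ≤ d * fnorm H := by
  have hpd : (1 + H).PosDef := PosDef.one.add_posSemidef hH
  obtain ⟨hS, hSS⟩ := matSqrt_spec hpd.posSemidef
  set S := matSqrt (1 + H)
  have hdet : IsUnit S.det := by
    have h := (Matrix.isUnit_iff_isUnit_det _).mp hpd.isUnit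
    rw [← hSS, Matrix.det_mul] at h
    exact isUnit_of_mul_isUnit_left h
  have h1 : S * S⁻¹ = 1 := Matrix.mul_nonsing_inv S hdet
  have h2 : S⁻¹ * S = 1 := Matrix.nonsing_inv_mul S hdet
  have hT : (S⁻¹).PosSemidef := hS.inv
  set T := S⁻¹
  have hTHT : T * H * T = 1 - T * T := by
    have : T * (1 + H) * T = 1 := by
      rw [← hSS, ← Matrix.mul_assoc, h2, Matrix.one_mul, h1]
    rw [Matrix.mul_add, Matrix.add_mul, Matrix.mul_one] at this
    rw [← this]; abel
  have hTsq : fnorm T ^ 2 ≤ d := by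
    have h := rtr_nonneg (hH.mul_mul_conjTranspose_same T)
    rw [hT.1.eq, hTHT, rtr_sub, rtr_one] at h
    rw [fnorm_sq_of_isHermitian hT.1]
    linarith
  have hK : (1 - T).IsHermitian := isHermitian_one.sub hT.1
  refine ⟨hT, ?_, ?_⟩
  · refine abs_le_of_sq_le_sq' ?_ (Nat.cast_nonneg d) |>.2
    exact hTsq.trans (by exact_mod_cast Nat.le_self_pow two_ne_zero d)
  -- The two terms have nonnegative inner product since `T ≥ 0`, so `1 - T` is no larger than `T H
  -- T`.
  · have e : T * H * T = (1 - T) + (1 - T) * T := by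
      rw [hTHT, Matrix.sub_mul, Matrix.one_mul]; abel
    have h3 : fnorm (1 - T) ^ 2 ≤ fnorm (T * H * T) ^ 2 := by
      have h := rtr_nonneg (hT.mul_mul_conjTranspose_same (1 - T))
      rw [hK.eq, Matrix.mul_assoc, rtr_mul_comm] at h
      have e2 : rtr ((1 - T)ᴴ * ((1 - T) * T)) = rtr (T * (1 - T) * (1 - T)) := by
        rw [hK.eq, ← Matrix.mul_assoc, rtr_mul_comm, Matrix.mul_assoc]
      rw [e, fnorm_add_sq, e2]
      nlinarith [sq_nonneg (fnorm ((1 - T) * T))]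
    have h4 : fnorm (1 - T) ≤ fnorm (T * H * T) :=
      abs_le_of_sq_le_sq' h3 (fnorm_nonneg _) |>.2
    calc fnorm (1 - T) ≤ fnorm (T * H * T) := h4
      _ ≤ fnorm T * fnorm H * fnorm T :=
        (fnorm_mul_le _ _).trans (mul_le_mul_of_nonneg_right (fnorm_mul_le _ _) (fnorm_nonneg _))
      _ = fnorm T ^ 2 * fnorm H := by ring
      _ ≤ d * fnorm H := mul_le_mul_of_nonneg_right hTsq (fnorm_nonneg _)

theorem stageTwo_posSemidef (E : Fin n → Op d) (i : Fin n) : (stageTwo E i).PosSemidef := by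
  have hH : (∑ k, matNegPart (E k)).PosSemidef :=
    posSemidef_sum _ fun k _ => negPart_posSemidef _
  have h := (posPart_posSemidef (E i)).mul_mul_conjTranspose_same
    (matSqrt (1 + ∑ k, matNegPart (E k)))⁻¹
  rw [(inv_sqrt_one_add hH).1.1.eq] at h
  exact h

/-- Operator form of `(x - y)² ≤ 2x² + 2y²`: with `K = 1 - T`, `(1 - K) F (1 - K) + (1 + K) F (1 +
K) = 2F + 2 K F K`, and the second term on the left is dropped. Thus the normalization by `T` costs
only second order in `K`. -/
theorem rtr_conj_mul_proj_le {F T E : Op d} (hF : F.PosSemidef) (hT : T.IsHermitian)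
    (hE : IsProj E) :
    rtr (T * F * T * E) ≤ 2 * rtr (F * E) + 2 * (fnorm F * fnorm (1 - T) ^ 2) := by
  obtain ⟨K, hK⟩ : ∃ K, K = 1 - T := ⟨_, rfl⟩
  have hKh : K.IsHermitian := hK ▸ isHermitian_one.sub hT
  have hTK : T = 1 - K := by rw [hK]; abel
  have h1 := rtr_mul_nonneg (hF.mul_mul_conjTranspose_same (1 + K)) hE.posSemidef
  rw [(isHermitian_one.add hKh).eq] at h1
  have e : T * F * T * E = (2 : ℝ) • (F * E) + (2 : ℝ) • (K * F * (K * E))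
      - (1 + K) * F * (1 + K) * E := by
    rw [hTK, two_smul, two_smul]
    simp only [Matrix.sub_mul, Matrix.mul_sub, Matrix.add_mul, Matrix.mul_add, Matrix.one_mul,
      Matrix.mul_one, Matrix.mul_assoc]
    abel
  have h2 : rtr (K * F * (K * E)) ≤ fnorm F * fnorm K ^ 2 := by
    refine (rtr_mul_le _ _).trans ?_
    calc fnorm (K * F) * fnorm (K * E) ≤ (fnorm K * fnorm F) * fnorm K :=
          mul_le_mul (fnorm_mul_le _ _) (hE.fnorm_mul_le' _) (fnorm_nonneg _)
            (mul_nonneg (fnorm_nonneg _) (fnorm_nonneg _))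
      _ = _ := by ring
  rw [e, rtr_sub, rtr_add, rtr_smul, rtr_smul, ← hK]
  linarith

theorem fnorm_conj_sub_le {T F P : Op d} {δ : ℝ} (hT : fnorm T ≤ d) (hK : fnorm (1 - T) ≤ d * δ)
    (hF : fnorm (F - P) ≤ δ) :
    fnorm (T * F * T - P) ≤ (d * d + d * d * fnorm P + d * fnorm P) * δ := by
  have e : T * F * T - P = T * (F - P) * T - (1 - T) * P * T - P * (1 - T) := by
    simp only [Matrix.sub_mul, Matrix.mul_sub, Matrix.one_mul, Matrix.mul_one]
    abel
  have hp := fnorm_nonneg P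
  have hδ : 0 ≤ δ := (fnorm_nonneg _).trans hF
  have hd : (0 : ℝ) ≤ d := Nat.cast_nonneg d
  have h1 : fnorm (T * (F - P) * T) ≤ d * δ * d :=
    (fnorm_mul_le _ _).trans (mul_le_mul ((fnorm_mul_le _ _).trans
      (mul_le_mul hT hF (fnorm_nonneg _) hd)) hT (fnorm_nonneg _) (mul_nonneg hd hδ))
  have h2 : fnorm ((1 - T) * P * T) ≤ d * δ * fnorm P * d :=
    (fnorm_mul_le _ _).trans (mul_le_mul ((fnorm_mul_le _ _).trans
      (mul_le_mul hK le_rfl hp (mul_nonneg hd hδ))) hT (fnorm_nonneg _)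
      (mul_nonneg (mul_nonneg hd hδ) hp))
  have h3 : fnorm (P * (1 - T)) ≤ fnorm P * (d * δ) :=
    (fnorm_mul_le _ _).trans (mul_le_mul le_rfl hK (fnorm_nonneg _) hp)
  have h4 := fnorm_sub_le (T * (F - P) * T) ((1 - T) * P * T)
  have h5 := fnorm_sub_le (T * (F - P) * T - (1 - T) * P * T) (P * (1 - T))
  rw [e]
  calc _ ≤ _ := h5
    _ ≤ fnorm (T * (F - P) * T) + fnorm ((1 - T) * P * T) + fnorm (P * (1 - T)) :=
      add_le_add_left h4 _
    _ ≤ d * δ * d + d * δ * fnorm P * d + fnorm P * (d * δ) := add_le_add (add_le_add h1 h2) h3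
    _ = _ := by ring

/-- The positive part is `A` plus the negative part. On the kernel, `A` contributes only its block
there, as `P E = 0`; the negative part contributes at most its whole trace, which `rtr_negPart_le`
controls. -/
theorem rtr_conj_mul_proj_le_of_perturbation {T A P E : Op d} {c δ : ℝ} (hP : P.PosSemidef)
    (hT : T.IsHermitian) (hTd : fnorm T ≤ d) (hK : fnorm (1 - T) ≤ d * δ) (hA : A.IsHermitian)
    (hE : IsProj E) (hPE : P * E = 0) (hc : 0 < c) (hcE : (P - c • (1 - E)).PosSemidef)
    (hδ : fnorm (A - P) ≤ δ) :
    rtr (T * matPosPart A * T * E) ≤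
      (2 / c + 2 * (fnorm P * d ^ 2 + 2 * d ^ 2)) * δ ^ 2 +
        4 * d * fnorm (E * (A - P) * E) := by
  have hmain := rtr_conj_mul_proj_le (posPart_posSemidef A) hT hE
  have hδ0 : 0 ≤ δ := (fnorm_nonneg _).trans hδ
  have hd : (0 : ℝ) ≤ d := Nat.cast_nonneg d
  have hFn : fnorm (matPosPart A) ≤ fnorm P + δ := by
    have h1 := fnorm_posPart_sub_le hA hP
    have h2 := fnorm_add_le (matPosPart A - P) P
    rw [sub_add_cancel] at h2
    linarith
  -- This a priori bound replaces one factor in the cubic term `δ ‖1 - T‖²`, so that the estimate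
  -- stays quadratic in `δ` for large `δ` too.
  have hK2 : fnorm (1 - T) ≤ 2 * d := by
    have h1 := fnorm_sub_le 1 T
    have h2 := fnorm_one_le (d := d)
    linarith
  have hAE : rtr (A * E) ≤ d * fnorm (E * (A - P) * E) := by
    have e : rtr (A * E) = rtr (E * (A - P) * E) := by
      rw [rtr_mul_comm (E * _), ← Matrix.mul_assoc, hE.idem, rtr_mul_comm E, Matrix.sub_mul, hPE,
        sub_zero]
    rw [e]
    exact rtr_le _
  have hGE : rtr (matNegPart A * E) ≤ δ ^ 2 / c + d * fnorm (E * (A - P) * E) := by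
    have h1 := rtr_mul_nonneg (negPart_posSemidef A) hE.compl.posSemidef
    rw [Matrix.mul_sub, Matrix.mul_one, rtr_sub] at h1
    have h2 := rtr_negPart_le hA hE hc hcE
    have h3 : fnorm (A - P) ^ 2 / c ≤ δ ^ 2 / c :=
      div_le_div_of_nonneg_right (pow_le_pow_left₀ (fnorm_nonneg _) hδ 2) hc.le
    linarith
  have hFE : rtr (matPosPart A * E) = rtr (A * E) + rtr (matNegPart A * E) := by
    nth_rw 2 [← posPart_sub_negPart hA]
    rw [Matrix.sub_mul, rtr_sub]; ring
  have hK0 := fnorm_nonneg (1 - T)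
  have hp := fnorm_nonneg P
  rw [hFE] at hmain
  generalize fnorm (E * (A - P) * E) = Z at *
  generalize fnorm (1 - T) = k at *
  generalize fnorm (matPosPart A) = f at *
  generalize fnorm P = p at *
  have hFK : f * k ^ 2 ≤ (p * d ^ 2 + 2 * d ^ 2) * δ ^ 2 := by
    calc f * k ^ 2 ≤ (p + δ) * k ^ 2 := by gcongr
      _ = p * (k * k) + δ * (k * k) := by ring
      _ ≤ p * ((d * δ) * (d * δ)) + δ * ((2 * d) * (d * δ)) := by gcongr
      _ = _ := by ring
  have e : (2 / c + 2 * (p * d ^ 2 + 2 * d ^ 2)) * δ ^ 2 =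
    2 * (δ ^ 2 / c) + 2 * ((p * d ^ 2 + 2 * d ^ 2) * δ ^ 2) := by ring
  linarith

section Sum
variable {P A : Fin n → Op d}

theorem sq_sum_fnorm_le (B : Fin n → Op d) :
    (∑ k, fnorm (B k)) ^ 2 ≤ n * ∑ k, fnorm (B k) ^ 2 := by
  have := sq_sum_le_card_mul_sum_sq (s := Finset.univ) (f := fun k => fnorm (B k))
  simpa using this

theorem fnorm_le_sum (B : Fin n → Op d) (i : Fin n) : fnorm (B i) ≤ ∑ k, fnorm (B k) :=
  Finset.single_le_sum (f := fun k => fnorm (B k)) (fun _ _ => fnorm_nonneg _) (Finset.mem_univ i)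

theorem stageTwo_factor (hP : IsPOVM P) (hA : ∀ k, (A k).IsHermitian) (i : Fin n) :
    ∃ T : Op d, stageTwo A i = T * matPosPart (A i) * T ∧ T.IsHermitian ∧ fnorm T ≤ d ∧
      fnorm (1 - T) ≤ d * ∑ k, fnorm (A k - P k) := by
  have hH : (∑ k, matNegPart (A k)).PosSemidef :=
    posSemidef_sum _ fun k _ => negPart_posSemidef _
  obtain ⟨hT, hTd, hKd⟩ := inv_sqrt_one_add hH
  have hHδ : fnorm (∑ k, matNegPart (A k)) ≤ ∑ k, fnorm (A k - P k) := (fnorm_sum_le _ _).trans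
    (Finset.sum_le_sum fun k _ => fnorm_negPart_le (hA k) (hP.posSemidef k))
  exact ⟨_, rfl, hT.1, hTd, hKd.trans (mul_le_mul_of_nonneg_left hHδ (Nat.cast_nonneg d))⟩

end Sum

theorem exists_stageTwo_bound {P : Fin n → Op d} (hP : IsPOVM P) (i : Fin n) :
    ∃ C : ℝ, 0 ≤ C ∧ ∀ A : Fin n → Op d, (∀ k, (A k).IsHermitian) →
      fnorm (stageTwo A i - P i) ^ 2 ≤ C * ∑ k, fnorm (A k - P k) ^ 2 := by
  have hp := fnorm_nonneg (P i)
  refine ⟨(d * d + d * d * fnorm (P i) + d * fnorm (P i)) ^ 2 * n, by positivity, fun A hA => ?_⟩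
  obtain ⟨T, hs, -, hTd, hK⟩ := stageTwo_factor hP hA i
  have hb := fnorm_conj_sub_le hTd hK ((fnorm_posPart_sub_le (hA i) (hP.posSemidef i)).trans
    (fnorm_le_sum (fun k => A k - P k) i))
  rw [← hs] at hb
  have h1 := pow_le_pow_left₀ (fnorm_nonneg _) hb 2
  rw [mul_pow] at h1
  rw [mul_assoc]
  exact h1.trans (mul_le_mul_of_nonneg_left (sq_sum_fnorm_le _) (sq_nonneg _))

theorem exists_stageTwo_kernel_bound {P : Fin n → Op d} (hP : IsPOVM P) (i : Fin n)
    {E : Op d} {c : ℝ} (hE : IsProj E) (hPE : P i * E = 0) (hc : 0 < c)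
    (hcE : (P i - c • (1 - E)).PosSemidef) :
    ∃ C : ℝ, 0 ≤ C ∧ ∀ A : Fin n → Op d, (∀ k, (A k).IsHermitian) →
      rtr (stageTwo A i * E) ≤
        C * (∑ k, fnorm (A k - P k) ^ 2 + fnorm (E * (A i - P i) * E)) := by
  have hp := fnorm_nonneg (P i)
  refine ⟨(2 / c + 2 * (fnorm (P i) * d ^ 2 + 2 * d ^ 2)) * n + 4 * d, by positivity,
    fun A hA => ?_⟩
  obtain ⟨T, hs, hT, hTd, hK⟩ := stageTwo_factor hP hA i
  have hb := rtr_conj_mul_proj_le_of_perturbation (hP.posSemidef i) hT hTd hK (hA i) hE hPE hc hcE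
    (fnorm_le_sum (fun k => A k - P k) i)
  rw [← hs] at hb
  have h1 := sq_sum_fnorm_le fun k => A k - P k
  have hZ : 0 ≤ fnorm (E * (A i - P i) * E) := fnorm_nonneg _
  have hX : 0 ≤ ∑ k, fnorm (A k - P k) ^ 2 := Finset.sum_nonneg fun k _ => sq_nonneg _
  have hB : 0 ≤ 2 / c + 2 * (fnorm (P i) * d ^ 2 + 2 * d ^ 2) := by positivity
  refine hb.trans ?_
  have h2 := mul_le_mul_of_nonneg_left h1 hB
  generalize fnorm (E * (A i - P i) * E) = Z at *
  generalize ∑ k, fnorm (A k - P k) ^ 2 = X at *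
  generalize 2 / c + 2 * (fnorm (P i) * d ^ 2 + 2 * d ^ 2) = B at *
  have h3 : 0 ≤ B * n * Z := by positivity
  have h4 : 0 ≤ 4 * (d : ℝ) * X := by positivity
  linarith

/-- Deterministic error bound for the two-stage estimate. -/
theorem exists_infidelity_stageTwo_le {P : Fin n → Op d} (hd : 1 ≤ d) (hP : IsPOVM P) {i : Fin n}
    (h0 : P i ≠ 0) {E : Op d} {c : ℝ} (hE : IsProj E) (hPE : P i * E = 0) (hc : 0 < c)
    (hcE : (P i - c • (1 - E)).PosSemidef) :
    ∃ C : ℝ, 0 ≤ C ∧ ∀ A : Fin n → Op d, (∀ k, (A k).IsHermitian) →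
      infidelity (stageTwo A i) (P i) ≤
        C * (∑ k, fnorm (A k - P k) ^ 2 + fnorm (E * (A i - P i) * E)) := by
  obtain ⟨C₁, hC₁, h₁⟩ := exists_infidelity_le hd (hP.posSemidef i) h0 hE hPE hc hcE
  obtain ⟨C₂, hC₂, h₂⟩ := exists_stageTwo_bound hP i
  obtain ⟨C₃, hC₃, h₃⟩ := exists_stageTwo_kernel_bound hP i hE hPE hc hcE
  refine ⟨C₁ * (C₂ + C₃), by positivity, fun A hA => ?_⟩
  have hZ : 0 ≤ fnorm (E * (A i - P i) * E) := fnorm_nonneg _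
  calc infidelity (stageTwo A i) (P i)
      ≤ C₁ * (fnorm (P i - stageTwo A i) ^ 2 + rtr (stageTwo A i * E)) :=
        h₁ _ (stageTwo_posSemidef A i)
    _ ≤ C₁ * (C₂ * ∑ k, fnorm (A k - P k) ^ 2 +
          C₃ * (∑ k, fnorm (A k - P k) ^ 2 + fnorm (E * (A i - P i) * E))) := by
        rw [fnorm_sub_comm]
        gcongr
        · exact h₂ A hA
        · exact h₃ A hA
    _ ≤ _ := by
        rw [mul_assoc C₁]
        gcongr
        nlinarith [mul_nonneg hC₂ hZ]

end StageTwo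

/-! ### Expectations over measurement data -/

section Prob
variable {d n : ℕ} {J : Type} [Fintype J]

theorem born_eq (P : Fin n → Op d) (ρ : Op d) (i : Fin n) : born P ρ i = rtr (P i * ρ) := rfl

theorem born_nonneg {P : Fin n → Op d} (hP : IsPOVM P) {ρ : Op d} (hρ : IsState ρ) (i : Fin n) :
    0 ≤ born P ρ i := rtr_mul_nonneg (hP.posSemidef i) hρ.posSemidef

theorem sum_born {P : Fin n → Op d} (hP : IsPOVM P) {ρ : Op d} (hρ : IsState ρ) :
    ∑ i, born P ρ i = 1 := by
  simp only [born_eq]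
  rw [← rtr_sum, ← Matrix.sum_mul, hP.sum_eq_one, Matrix.one_mul, rtr, hρ.trace_eq_one]
  simp

theorem sum_prod_apply {ι κ : Type*} [Fintype ι] [DecidableEq ι] [Fintype κ]
    (g : ι → κ → ℝ) : ∑ ω : ι → κ, ∏ k, g k (ω k) = ∏ k, ∑ x, g k x := by
  rw [Finset.prod_univ_sum, Fintype.piFinset_univ]

variable {P : Fin n → Op d} {ρ : J → Op d} {m : ℕ}

theorem dataProb_nonneg {P : Fin n → Op d} {ρ : J → Op d} {m : ℕ} (hP : IsPOVM P)
    (hρ : ∀ j, IsState (ρ j)) (ω : Data J m n) : 0 ≤ dataProb P ρ ω :=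
  Finset.prod_nonneg fun j _ => Finset.prod_nonneg fun _ _ => born_nonneg hP (hρ j) _

variable [DecidableEq J]

/-- Independence of the copies; normalization and second moments follow by a suitable choice of the
factors. -/
theorem expect_prod (u : J → Fin m → Fin n → ℝ) :
    expect P ρ m (fun ω => ∏ j, ∏ c, u j c (ω j c)) =
      ∏ j, ∏ c, ∑ x, born P (ρ j) x * u j c x := by
  unfold expect dataProb
  simp only [← Finset.prod_mul_distrib]
  rw [sum_prod_apply (fun j (v : Fin m → Fin n) => ∏ c, born P (ρ j) (v c) * u j c (v c))]
  exact Finset.prod_congr rfl fun j _ =>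
    sum_prod_apply fun c x => born P (ρ j) x * u j c x

theorem expect_add (f g : Data J m n → ℝ) :
    expect P ρ m (fun ω => f ω + g ω) = expect P ρ m f + expect P ρ m g := by
  simp [expect, mul_add, Finset.sum_add_distrib]

theorem expect_const_mul (a : ℝ) (f : Data J m n → ℝ) :
    expect P ρ m (fun ω => a * f ω) = a * expect P ρ m f := by
  simp only [expect, Finset.mul_sum]
  exact Finset.sum_congr rfl fun ω _ => by ring

theorem expect_sum {ι : Type*} (s : Finset ι) (f : ι → Data J m n → ℝ) :
    expect P ρ m (fun ω => ∑ k ∈ s, f k ω) = ∑ k ∈ s, expect P ρ m (f k) := by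
  simp only [expect, Finset.mul_sum]
  exact Finset.sum_comm

variable (hP : IsPOVM P) (hρ : ∀ j, IsState (ρ j))
include hP hρ

theorem expect_mono {f g : Data J m n → ℝ} (h : ∀ ω, f ω ≤ g ω) :
    expect P ρ m f ≤ expect P ρ m g :=
  Finset.sum_le_sum fun ω _ => mul_le_mul_of_nonneg_left (h ω) (dataProb_nonneg hP hρ ω)

theorem expect_nonneg {f : Data J m n → ℝ} (h : ∀ ω, 0 ≤ f ω) : 0 ≤ expect P ρ m f :=
  Finset.sum_nonneg fun ω _ => mul_nonneg (dataProb_nonneg hP hρ ω) (h ω)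

theorem expect_const (a : ℝ) : expect P ρ m (fun _ => a) = a := by
  have h := expect_prod (P := P) (ρ := ρ) (m := m) fun _ _ _ => 1
  simp only [mul_one, Finset.prod_const_one, sum_born hP (hρ _)] at h
  have h2 := expect_const_mul (P := P) (ρ := ρ) (m := m) a fun _ => 1
  simpa [h] using h2

theorem expect_mul_apply (h : Fin n → ℝ) (j : J) (c c' : Fin m)
    (hzero : ∑ x, born P (ρ j) x * h x = 0) :
    expect P ρ m (fun ω => h (ω j c) * h (ω j c')) =
      if c = c' then ∑ x, born P (ρ j) x * h x ^ 2 else 0 := by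
  -- One factor per copy. For `c = c'` the two conditions coincide and give `h²`; for `c ≠ c'` the
  -- factor at `c` has mean zero.
  set u : J → Fin m → Fin n → ℝ := fun j' e x =>
    if j' = j then (if e = c then h x else 1) * (if e = c' then h x else 1) else 1 with hu
  have e : (fun ω : Data J m n => h (ω j c) * h (ω j c')) =
      fun ω => ∏ j, ∏ c, u j c (ω j c) := by
    funext ω
    rw [Fintype.prod_eq_single j fun j' hj' => by simp [hu, hj']]
    simp only [hu, if_true, Finset.prod_mul_distrib, Finset.prod_ite_eq', Finset.mem_univ]
  rw [e, expect_prod, Fintype.prod_eq_single j fun j' hj' => by simp [hu, hj', sum_born hP (hρ _)]]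
  split_ifs with hc
  · subst hc
    rw [Fintype.prod_eq_single c fun e he => by simp [hu, he, sum_born hP (hρ _)]]
    simp [hu, sq]
  · refine Finset.prod_eq_zero (Finset.mem_univ c) ?_
    simpa [hu, hc] using hzero

/-- Binomial variance `p (1 - p) / m`. Keeping the factor `p` is essential: rare outcomes are
estimated with smaller error, which is what the adaptive basis exploits. -/
theorem expect_freq_sub_sq_le (hm : 0 < m) (i : Fin n) (j : J) :
    expect P ρ m (fun ω => (freq ω i j - born P (ρ j) i) ^ 2) ≤ born P (ρ j) i / m := by
  have hm' : (0 : ℝ) < m := by exact_mod_cast hm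
  set p := born P (ρ j) i with hp
  have hp0 : 0 ≤ p := born_nonneg hP (hρ j) i
  set h : Fin n → ℝ := fun x => (if x = i then 1 else 0) - p with hh
  have hsum := sum_born hP (hρ j)
  have hzero : ∑ x, born P (ρ j) x * h x = 0 := by
    simp only [hh, mul_sub, Finset.sum_sub_distrib, ← Finset.sum_mul, hsum]
    simp [hp]
  have hvar : ∑ x, born P (ρ j) x * h x ^ 2 = p - p ^ 2 := by
    have : ∀ x, born P (ρ j) x * h x ^ 2 =
        born P (ρ j) x * (if x = i then 1 else 0) * (1 - 2 * p) + born P (ρ j) x * p ^ 2 := by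
      intro x
      simp only [hh]
      split_ifs <;> ring
    simp only [this, Finset.sum_add_distrib, ← Finset.sum_mul, hsum]
    simp [← hp]
    ring
  have e : ∀ ω : Data J m n, (freq ω i j - p) ^ 2 =
      (1 / (m : ℝ) ^ 2) * ∑ c, ∑ c', h (ω j c) * h (ω j c') := by
    intro ω
    have : freq ω i j - p = (1 / (m : ℝ)) * ∑ c, h (ω j c) := by
      simp only [hh, Finset.sum_sub_distrib, Finset.sum_boole, freq]
      simp
      field_simp
    rw [this, mul_pow, sq (∑ c, h (ω j c)), Finset.sum_mul_sum]
    ring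
  simp only [e]
  rw [expect_const_mul, expect_sum]
  simp only [expect_sum, expect_mul_apply hP hρ h j _ _ hzero, Finset.sum_ite_eq, Finset.mem_univ,
    if_true, hvar, Finset.sum_const, Finset.card_univ, Fintype.card_fin, nsmul_eq_mul]
  rw [div_mul_eq_mul_div, one_mul, div_le_div_iff₀ (by positivity) hm']
  nlinarith [mul_nonneg (sq_nonneg p) (sq_nonneg (m : ℝ))]

end Prob

/-! ### Constrained least squares -/

section LeastSquares
variable {d n : ℕ} {Ω : Fin d × Fin d → Op d}

/-- The coefficients form a square matrix `U`. Orthonormality is `U U† = 1`, hence `U† U = 1`, which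
is completeness. -/
theorem IsOperatorBasis.sum_trace_smul (hΩ : IsOperatorBasis Ω) (A : Op d) :
    ∑ a, (Ω a * A).trace • Ω a = A := by
  let U : Matrix (Fin d × Fin d) (Fin d × Fin d) ℂ := Matrix.of fun a x => star (Ω a x.1 x.2)
  have hU : U * Uᴴ = 1 := by
    ext a b
    have h := hΩ.orthonormal a b
    rw [Matrix.one_apply, ← h]
    simp only [Matrix.mul_apply, Matrix.trace, Matrix.diag_apply, conjTranspose_apply, U,
      Matrix.of_apply, star_star, Fintype.sum_prod_type]
    exact Finset.sum_comm
  have hU' : Uᴴ * U = 1 := mul_eq_one_comm.mp hU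
  ext r s
  have hrs : ∀ x : Fin d × Fin d, 
      ∑ a, Ω a r s * star (Ω a x.1 x.2) = if (r, s) = x then 1 else 0 := by
    intro x
    have := congrFun (congrFun hU' (r, s)) x
    rw [Matrix.one_apply] at this
    rw [← this]
    simp [Matrix.mul_apply, conjTranspose_apply, U]
  have htr : ∀ a, (Ω a * A).trace = ∑ x : Fin d × Fin d, star (Ω a x.1 x.2) * A x.1 x.2 := by
    intro a
    conv_lhs => rw [← (hΩ.isHermitian a).eq]
    simp only [Matrix.mul_apply, Matrix.trace, Matrix.diag_apply, conjTranspose_apply,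
      Fintype.sum_prod_type]
    exact Finset.sum_comm
  calc (∑ a, (Ω a * A).trace • Ω a) r s
      = ∑ a, ∑ x : Fin d × Fin d, Ω a r s * star (Ω a x.1 x.2) * A x.1 x.2 := by
        simp only [Matrix.sum_apply, Matrix.smul_apply, smul_eq_mul, htr, Finset.sum_mul]
        exact Finset.sum_congr rfl fun a _ => Finset.sum_congr rfl fun x _ => by ring
    _ = ∑ x : Fin d × Fin d, (if (r, s) = x then 1 else 0) * A x.1 x.2 := by
        rw [Finset.sum_comm]
        exact Finset.sum_congr rfl fun x _ => by rw [← Finset.sum_mul, hrs]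
    _ = A r s := by simp

theorem trace_mul_real {A B : Op d} (hA : A.IsHermitian) (hB : B.IsHermitian) :
    (A * B).trace = (rtr (A * B) : ℂ) := by
  refine (Complex.conj_eq_iff_re.mp ?_).symm
  have : star (A * B).trace = (A * B)ᴴ.trace := (Matrix.trace_conjTranspose _).symm
  rw [starRingEnd_apply, this, conjTranspose_mul, hA.eq, hB.eq, Matrix.trace_mul_comm]

theorem IsOperatorBasis.sum_coords (hΩ : IsOperatorBasis Ω) {A : Op d} (hA : A.IsHermitian) :
    ∑ a, (coords Ω A a : ℂ) • Ω a = A := by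
  conv_rhs => rw [← hΩ.sum_trace_smul A]
  refine Finset.sum_congr rfl fun a _ => ?_
  rw [Matrix.trace_mul_comm, trace_mul_real hA (hΩ.isHermitian a)]
  rfl

theorem IsOperatorBasis.isHermitian_sum (hΩ : IsOperatorBasis Ω) (v : Fin d × Fin d → ℝ) :
    (∑ a, (v a : ℂ) • Ω a).IsHermitian := by
  rw [IsHermitian, conjTranspose_sum]
  refine Finset.sum_congr rfl fun a _ => ?_
  rw [conjTranspose_smul, (hΩ.isHermitian a).eq]
  simp

theorem IsOperatorBasis.fnorm_eq_one (hΩ : IsOperatorBasis Ω) (a) : fnorm (Ω a) = 1 := by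
  have h := fnorm_sq (Ω a)
  rw [rtr, hΩ.orthonormal, if_pos rfl, Complex.one_re] at h
  nlinarith [fnorm_nonneg (Ω a)]

variable {J : Type} {ρ : J → Op d}

theorem designMatrix_mulVec (Ω : Fin d × Fin d → Op d) (ρ : J → Op d) (v : Fin d × Fin d → ℝ)
    (j : J) : (designMatrix Ω ρ *ᵥ v) j = rtr ((∑ a, (v a : ℂ) • Ω a) * ρ j) := by
  simp only [designMatrix, Matrix.mulVec, dotProduct, Matrix.of_apply, coords, Matrix.sum_mul,
    rtr_sum]
  refine Finset.sum_congr rfl fun a _ => ?_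
  rw [Matrix.smul_mul, rtr, Matrix.trace_smul, Matrix.trace_mul_comm]
  simp [mul_comm]

/-- The states determine every Hermitian matrix through its expectation values. -/
def Complete (ρ : J → Op d) : Prop :=
  ∀ H : Op d, H.IsHermitian → (∀ j, rtr (H * ρ j) = 0) → H = 0

theorem SpansHermitian.complete (h : SpansHermitian ρ) : Complete ρ := by
  intro H hH h0
  have key : ∀ B ∈ Submodule.span ℝ (Set.range ρ), rtr (H * B) = 0 := by
    intro B hB
    induction hB using Submodule.span_induction with
    | mem x hx => obtain ⟨j, rfl⟩ := hx; exact h0 j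
    | zero => simp
    | add x y _ _ hx hy => rw [Matrix.mul_add, rtr_add, hx, hy, add_zero]
    | smul c x _ hx => rw [Matrix.mul_smul, rtr_smul, hx, mul_zero]
  have h1 := fnorm_sq_of_isHermitian hH
  rw [key H (h H hH)] at h1
  exact eq_zero_of_fnorm_eq_zero (pow_eq_zero_iff two_ne_zero |>.mp h1)

variable [Fintype J]

/-- If `XᵀX v = 0` then `X v = 0`, so the Hermitian matrix with coordinates `v` has zero expectation
in every probe state and vanishes. -/
theorem designMatrix_gram_inv (hΩ : IsOperatorBasis Ω) (hρ : Complete ρ) :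
    ((designMatrix Ω ρ)ᵀ * designMatrix Ω ρ)⁻¹ * ((designMatrix Ω ρ)ᵀ * designMatrix Ω ρ) = 1 := by
  set X := designMatrix Ω ρ
  apply Matrix.nonsing_inv_mul
  rw [← Matrix.isUnit_iff_isUnit_det, ← Matrix.mulVec_injective_iff_isUnit]
  rw [← Matrix.coe_mulVecLin, ← LinearMap.ker_eq_bot, LinearMap.ker_eq_bot']
  intro v hv
  rw [Matrix.mulVecLin_apply] at hv
  have h1 : X *ᵥ v = 0 := by
    have h2 : (X *ᵥ v) ⬝ᵥ (X *ᵥ v) = 0 := by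
      have := congrArg (fun w => v ⬝ᵥ w) hv
      simp only [dotProduct_zero] at this
      rw [← this, ← Matrix.mulVec_mulVec, Matrix.dotProduct_mulVec v Xᵀ, Matrix.vecMul_transpose]
    exact dotProduct_self_eq_zero.mp h2
  have h3 : ∑ a, (v a : ℂ) • Ω a = 0 := hρ _ (hΩ.isHermitian_sum v) fun j => by
    rw [← designMatrix_mulVec]; exact congrFun h1 j
  funext b
  have h4 := congrArg (fun A => ((Ω b)ᴴ * A).trace) h3
  simp only [Matrix.mul_sum, Matrix.trace_sum, Matrix.mul_smul, Matrix.trace_smul,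
    hΩ.orthonormal, Matrix.mul_zero, Matrix.trace_zero, smul_eq_mul] at h4
  simpa using h4

/-- `X` sends the coordinates of `1` to the all-ones vector and those of `P i` to the Born
probabilities. As `(XᵀX)⁻¹Xᵀ` is a left inverse of `X`, the offsets `1/n` cancel and only the
frequency errors remain. -/
theorem clsCoords_sub_coords {m : ℕ} {P : Fin n → Op d}
    (hΩ : IsOperatorBasis Ω) (hP : IsPOVM P) (hρ : ∀ j, IsState (ρ j)) (hc : Complete ρ)
    (ω : Data J m n) (i : Fin n) :
    clsCoords Ω ρ ω i - coords Ω (P i) =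
      (((designMatrix Ω ρ)ᵀ * designMatrix Ω ρ)⁻¹ * (designMatrix Ω ρ)ᵀ) *ᵥ
        fun j => freq ω i j - born P (ρ j) i := by
  have hX := designMatrix_gram_inv hΩ hc
  have h1 : designMatrix Ω ρ *ᵥ coords Ω (1 : Op d) = fun _ => 1 := by
    funext j
    rw [designMatrix_mulVec, hΩ.sum_coords isHermitian_one, Matrix.one_mul, rtr,
      (hρ j).trace_eq_one, Complex.one_re]
  have h2 : designMatrix Ω ρ *ᵥ coords Ω (P i) = fun j => born P (ρ j) i := by
    funext j
    rw [designMatrix_mulVec, hΩ.sum_coords (hP.posSemidef i).1]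
    rfl
  unfold clsCoords
  simp only
  set X := designMatrix Ω ρ
  have hL : ∀ v, ((Xᵀ * X)⁻¹ * Xᵀ) *ᵥ (X *ᵥ v) = v := fun v => by
    rw [Matrix.mulVec_mulVec, Matrix.mul_assoc, hX, Matrix.one_mulVec]
  have e1 : (fun j => freq ω i j - 1 / (n : ℝ)) =
      (fun j => freq ω i j - born P (ρ j) i) + X *ᵥ coords Ω (P i)
        - (1 / (n : ℝ)) • X *ᵥ coords Ω 1 := by
    rw [h1, h2]
    funext j
    simp
  rw [e1, Matrix.mulVec_sub, Matrix.mulVec_add, hL, Matrix.mulVec_smul, hL]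
  abel

theorem stageOne_sub {m : ℕ} {P : Fin n → Op d} (hΩ : IsOperatorBasis Ω) (hP : IsPOVM P)
    (ω : Data J m n) (i : Fin n) :
    stageOne Ω ρ ω i - P i = ∑ a, ((clsCoords Ω ρ ω i - coords Ω (P i)) a : ℂ) • Ω a := by
  conv_lhs => rw [← hΩ.sum_coords (hP.posSemidef i).1]
  rw [stageOne, ← Finset.sum_sub_distrib]
  refine Finset.sum_congr rfl fun a _ => ?_
  rw [← sub_smul]
  simp

theorem stageOne_isHermitian {m : ℕ} (hΩ : IsOperatorBasis Ω) (ω : Data J m n) (i : Fin n) :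
    (stageOne Ω ρ ω i).IsHermitian := hΩ.isHermitian_sum _

/-- The error of the first stage is controlled by the errors of the frequencies. -/
theorem exists_stageOne_error_le (hΩ : IsOperatorBasis Ω) (hρ : ∀ j, IsState (ρ j))
    (hc : Complete ρ) : ∃ C : ℝ, 0 ≤ C ∧ ∀ (P : Fin n → Op d), IsPOVM P →
      ∀ (m : ℕ) (ω : Data J m n) (i : Fin n),
        fnorm (stageOne Ω ρ ω i - P i) ^ 2 ≤ C * ∑ j, (freq ω i j - born P (ρ j) i) ^ 2 := by
  set L := ((designMatrix Ω ρ)ᵀ * designMatrix Ω ρ)⁻¹ * (designMatrix Ω ρ)ᵀ with hL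
  refine ⟨(∑ a, ∑ j, |L a j|) ^ 2, sq_nonneg _, fun P hP m ω i => ?_⟩
  set ε : J → ℝ := fun j => freq ω i j - born P (ρ j) i with hε
  have hS : 0 ≤ ∑ j, ε j ^ 2 := Finset.sum_nonneg fun j _ => sq_nonneg _
  have hj : ∀ j, |ε j| ≤ Real.sqrt (∑ j, ε j ^ 2) := fun j => by
    apply Real.abs_le_sqrt
    exact Finset.single_le_sum (f := fun j => ε j ^ 2) (fun _ _ => sq_nonneg _) (Finset.mem_univ j)
  have h1 : fnorm (stageOne Ω ρ ω i - P i) ≤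
      (∑ a, ∑ j, |L a j|) * Real.sqrt (∑ j, ε j ^ 2) := by
    rw [stageOne_sub hΩ hP, clsCoords_sub_coords hΩ hP hρ hc]
    refine (fnorm_sum_le _ _).trans ?_
    rw [Finset.sum_mul]
    refine Finset.sum_le_sum fun a _ => ?_
    rw [fnorm_smul, hΩ.fnorm_eq_one, mul_one, Complex.norm_real, Real.norm_eq_abs, Finset.sum_mul]
    refine (Finset.abs_sum_le_sum_abs _ _).trans (Finset.sum_le_sum fun j _ => ?_)
    rw [abs_mul]
    exact mul_le_mul_of_nonneg_left (hj j) (abs_nonneg _)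
  calc _ ≤ ((∑ a, ∑ j, |L a j|) * Real.sqrt (∑ j, ε j ^ 2)) ^ 2 :=
        pow_le_pow_left₀ (fnorm_nonneg _) h1 2
    _ = _ := by rw [mul_pow, Real.sq_sqrt hS]

/-- With as many states as parameters, the first stage reproduces the frequencies. -/
theorem rtr_stageOne_sub_mul {ρ : Fin d × Fin d → Op d} {m : ℕ} {P : Fin n → Op d}
    (hΩ : IsOperatorBasis Ω) (hP : IsPOVM P) (hρ : ∀ j, IsState (ρ j)) (hc : Complete ρ)
    (ω : Data (Fin d × Fin d) m n) (i : Fin n) (j : Fin d × Fin d) :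
    rtr ((stageOne Ω ρ ω i - P i) * ρ j) = freq ω i j - born P (ρ j) i := by
  have hX := designMatrix_gram_inv hΩ hc
  rw [stageOne_sub hΩ hP, ← designMatrix_mulVec, clsCoords_sub_coords hΩ hP hρ hc]
  -- The design matrix is square here, so its left inverse is also a right inverse.
  rw [← Matrix.mul_assoc] at hX
  rw [Matrix.mulVec_mulVec, mul_eq_one_comm.mp hX, Matrix.one_mulVec]

end LeastSquares

/-! ### Generalized Pauli basis states -/

section KetBra
variable {d : ℕ}

theorem ketBra_conjTranspose (u v : Fin d → ℂ) : (ketBra u v)ᴴ = ketBra v u := by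
  simp [ketBra, conjTranspose_vecMulVec]

theorem ketBra_mul_mul (A : Op d) (u v w x : Fin d → ℂ) :
    ketBra u v * A * ketBra w x = (A * ketBra w v).trace • ketBra u x := by
  rw [Matrix.mul_assoc]
  simp only [ketBra, Matrix.mul_vecMulVec, Matrix.trace_vecMulVec, Matrix.vecMulVec_mulVec]
  rw [op_smul_eq_smul, Matrix.smul_vecMulVec, dotProduct_comm]

theorem ketBra_posSemidef (u : Fin d → ℂ) : (ketBra u u).PosSemidef :=
  posSemidef_vecMulVec_self_star u

theorem trace_ketBra (u v : Fin d → ℂ) : (ketBra u v).trace = star v ⬝ᵥ u := by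
  rw [ketBra, Matrix.trace_vecMulVec, dotProduct_comm]

theorem ketBra_add_smul (u v : Fin d → ℂ) (c : ℂ) :
    ketBra (u + c • v) (u + c • v) = ketBra u u + star c • ketBra u v + c • ketBra v u +
      (c * star c) • ketBra v v := by
  simp only [ketBra, star_add, star_smul, Matrix.vecMulVec_add, Matrix.add_vecMulVec,
    Matrix.smul_vecMulVec, Matrix.vecMulVec_smul, smul_add, mul_comm c, mul_smul]
  abel

/-- Orthonormality of a family of `d` vectors. -/
def IsONB (b : Fin d → Fin d → ℂ) : Prop :=
  ∀ k l, star (b k) ⬝ᵥ b l = if k = l then 1 else 0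

variable {b : Fin d → Fin d → ℂ} (hb : IsONB b)
include hb

theorem IsONB.fnorm_ketBra (k l : Fin d) : fnorm (ketBra (b k) (b l)) = 1 := by
  have h := fnorm_sq (ketBra (b k) (b l))
  rw [ketBra_conjTranspose, ← Matrix.mul_one (ketBra (b l) (b k)), ketBra_mul_mul,
    Matrix.one_mul, trace_ketBra, hb, if_pos rfl, one_smul, rtr, trace_ketBra, hb, if_pos rfl] at h
  nlinarith [fnorm_nonneg (ketBra (b k) (b l)), Complex.one_re]

theorem IsONB.isProj (k : Fin d) : IsProj (ketBra (b k) (b k)) := by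
  refine ⟨ketBra_conjTranspose _ _, ?_⟩
  nth_rw 1 [← Matrix.mul_one (ketBra (b k) (b k))]
  rw [ketBra_mul_mul, Matrix.one_mul, trace_ketBra, hb, if_pos rfl, one_smul]

theorem IsONB.sum_ketBra : ∑ k, ketBra (b k) (b k) = 1 := by
  let U : Op d := Matrix.of fun k r => star (b k r)
  have hU : U * Uᴴ = 1 := by
    ext k l
    rw [Matrix.one_apply, ← hb k l]
    simp [Matrix.mul_apply, U, dotProduct]
  have hU' : Uᴴ * U = 1 := mul_eq_one_comm.mp hU
  rw [← hU']
  ext r s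
  simp [Matrix.sum_apply, Matrix.mul_apply, U, ketBra, Matrix.vecMulVec_apply]

/-- A compression in terms of the matrix elements in an orthonormal basis. -/
theorem IsONB.fnorm_compress_le (D E : Op d) (hE : E.IsHermitian) :
    fnorm (E * D * E) ≤ ∑ k, ∑ l, fnorm (E * ketBra (b k) (b k)) * fnorm (E * ketBra (b l) (b l)) *
      ‖(D * ketBra (b l) (b k)).trace‖ := by
  have e : E * D * E = ∑ k, ∑ l, (E * ketBra (b k) (b k)) *
      ((ketBra (b k) (b k) * D * ketBra (b l) (b l)) * (ketBra (b l) (b l) * E)) := by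
    have h1 : ∀ k l, (E * ketBra (b k) (b k)) *
        ((ketBra (b k) (b k) * D * ketBra (b l) (b l)) * (ketBra (b l) (b l) * E)) =
        E * ketBra (b k) (b k) * D * (ketBra (b l) (b l) * E) := fun k l => by
      calc _ = E * (ketBra (b k) (b k) * ketBra (b k) (b k)) * D *
            ((ketBra (b l) (b l) * ketBra (b l) (b l)) * E) := by simp only [Matrix.mul_assoc]
        _ = _ := by rw [(hb.isProj k).idem, (hb.isProj l).idem]
    simp only [h1, ← Matrix.mul_sum, ← Matrix.sum_mul, hb.sum_ketBra, Matrix.one_mul,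
      Matrix.mul_one]
  rw [e]
  refine (fnorm_sum_le _ _).trans (Finset.sum_le_sum fun k _ =>
    (fnorm_sum_le _ _).trans (Finset.sum_le_sum fun l _ => ?_))
  have h2 : fnorm (ketBra (b l) (b l) * E) = fnorm (E * ketBra (b l) (b l)) := by
    rw [← fnorm_conjTranspose, conjTranspose_mul, hE.eq, ketBra_conjTranspose]
  have h3 : fnorm (ketBra (b k) (b k) * D * ketBra (b l) (b l)) =
      ‖(D * ketBra (b l) (b k)).trace‖ := by
    rw [ketBra_mul_mul, fnorm_smul, hb.fnorm_ketBra, mul_one]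
  calc _ ≤ fnorm (E * ketBra (b k) (b k)) * (fnorm (ketBra (b k) (b k) * D * ketBra (b l) (b l)) *
        fnorm (ketBra (b l) (b l) * E)) :=
        (fnorm_mul_le _ _).trans (mul_le_mul_of_nonneg_left (fnorm_mul_le _ _) (fnorm_nonneg _))
    _ = _ := by rw [h2, h3]; ring

omit hb in
theorem gpb_of_eq (b : Fin d → Fin d → ℂ) (k : Fin d) : gpb b (k, k) = ketBra (b k) (b k) := by
  simp [gpb]

omit hb in
theorem gpb_of_lt (b : Fin d → Fin d → ℂ) {k l : Fin d} (h : k < l) :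
    gpb b (k, l) = (1 / 2 : ℝ) • ketBra (b k + (1 : ℂ) • b l) (b k + (1 : ℂ) • b l) := by
  simp only [gpb, h.ne, h, if_true, if_false, min_eq_left h.le, max_eq_right h.le]
  rw [ketBra_add_smul, ← Complex.coe_smul]
  congr 1
  · norm_num
  · simp; abel

omit hb in
theorem gpb_of_gt (b : Fin d → Fin d → ℂ) {k l : Fin d} (h : k < l) :
    gpb b (l, k) = (1 / 2 : ℝ) • ketBra (b k + Complex.I • b l) (b k + Complex.I • b l) := by
  simp only [gpb, h.ne', h.not_gt, if_false, min_eq_right h.le, max_eq_left h.le]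
  rw [ketBra_add_smul, ← Complex.coe_smul]
  congr 1
  · norm_num
  · simp; abel

omit hb in
/-- The three kinds of generalized Pauli basis states. -/
theorem gpb_cases (b : Fin d → Fin d → ℂ) (a : Fin d × Fin d) :
    gpb b a = ketBra (b a.1) (b a.1) ∨ ∃ (k l : Fin d) (c : ℂ), k ≠ l ∧
      (a = (k, l) ∨ a = (l, k)) ∧ c * star c = 1 ∧
      gpb b a = (1 / 2 : ℝ) • ketBra (b k + c • b l) (b k + c • b l) := by
  obtain ⟨k, l⟩ := a
  rcases lt_trichotomy k l with h | h | h
  · exact Or.inr ⟨k, l, 1, h.ne, Or.inl rfl, by simp, gpb_of_lt b h⟩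
  · subst h; exact Or.inl (gpb_of_eq b k)
  · exact Or.inr ⟨l, k, Complex.I, h.ne, Or.inr rfl, by simp, gpb_of_gt b h⟩

theorem IsONB.gpb_isState (a : Fin d × Fin d) : IsState (gpb b a) := by
  rcases gpb_cases b a with h | ⟨k, l, c, hkl, -, hc, h⟩
  · rw [h]
    exact ⟨ketBra_posSemidef _, by rw [trace_ketBra, hb, if_pos rfl]⟩
  · rw [h]
    refine ⟨(ketBra_posSemidef _).smul (by norm_num), ?_⟩
    rw [ketBra_add_smul, hc]
    have hbo : ∀ k l, star (b k) ⬝ᵥ b l = if k = l then 1 else 0 := hb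
    simp only [Matrix.trace_smul, Matrix.trace_add, trace_ketBra, hbo, if_neg hkl, if_neg hkl.symm,
      if_true]
    simp
    norm_num

omit hb in
-- Parallelogram identity: the companion vector `b k - c b l` has nonnegative expectation.
-- Superposition states therefore inherit small outcome probabilities from their two basis vectors.
theorem rtr_mul_gpb_le (b : Fin d → Fin d → ℂ) {P : Op d} (hP : P.PosSemidef) (a : Fin d × Fin d) :
    rtr (P * gpb b a) ≤ rtr (P * ketBra (b a.1) (b a.1)) + rtr (P * ketBra (b a.2) (b a.2)) := by
  rcases gpb_cases b a with h | ⟨k, l, c, hkl, ha, hc, h⟩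
  · rw [h]
    linarith [rtr_mul_nonneg hP (ketBra_posSemidef (b a.2))]
  · have h1 := rtr_mul_nonneg hP (ketBra_posSemidef (b k + (-c) • b l))
    have e : (2 : ℝ) • gpb b a + ketBra (b k + (-c) • b l) (b k + (-c) • b l) =
        (2 : ℝ) • ketBra (b k) (b k) + (2 : ℝ) • ketBra (b l) (b l) := by
      rw [h, smul_smul, ketBra_add_smul, ketBra_add_smul, star_neg, neg_mul_neg, hc]
      norm_num
      rw [two_smul, two_smul]
      abel
    have h2 := congrArg (fun A => rtr (P * A)) e
    simp only [Matrix.mul_add, rtr_add, Matrix.mul_smul, rtr_smul] at h2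
    rcases ha with rfl | rfl <;> simp only <;> linarith

omit hb in
theorem star_trace_mul_ketBra {D : Op d} (hD : D.IsHermitian) (u v : Fin d → ℂ) :
    star (D * ketBra u v).trace = (D * ketBra v u).trace := by
  rw [← Matrix.trace_conjTranspose, conjTranspose_mul, hD.eq, ketBra_conjTranspose,
    Matrix.trace_mul_comm]

omit hb in
/-- Matrix elements of a Hermitian matrix from its expectation values in the generalized Pauli
basis states. -/
theorem normSq_trace_mul_ketBra_le (b : Fin d → Fin d → ℂ) {D : Op d} (hD : D.IsHermitian)
    (k l : Fin d) :
    ‖(D * ketBra (b l) (b k)).trace‖ ^ 2 ≤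
      2 * (rtr (D * gpb b (k, l)) ^ 2 + rtr (D * gpb b (l, k)) ^ 2 +
        rtr (D * gpb b (k, k)) ^ 2 + rtr (D * gpb b (l, l)) ^ 2) := by
  -- If `r`, `s`, `p`, `q` are the four expectation values in the order listed, the matrix element
  -- has real part `r - (p + q)/2` and imaginary part `(p + q)/2 - s`.
  have key : ∀ k l : Fin d, k < l → ‖(D * ketBra (b l) (b k)).trace‖ ^ 2 ≤
      2 * (rtr (D * gpb b (k, l)) ^ 2 + rtr (D * gpb b (l, k)) ^ 2 +
        rtr (D * gpb b (k, k)) ^ 2 + rtr (D * gpb b (l, l)) ^ 2) := by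
    intro k l h
    rw [gpb_of_eq, gpb_of_eq, gpb_of_lt b h, gpb_of_gt b h, ketBra_add_smul, ketBra_add_smul]
    simp only [Matrix.mul_smul, rtr_smul, Matrix.mul_add, rtr_add]
    have hz := star_trace_mul_ketBra hD (b l) (b k)
    simp only [rtr, Matrix.trace_smul, ← hz]
    generalize (D * ketBra (b l) (b k)).trace = z
    generalize (D * ketBra (b k) (b k)).trace = p
    generalize (D * ketBra (b l) (b l)).trace = q
    rw [← Complex.normSq_eq_norm_sq, Complex.normSq_apply]
    simp
    nlinarith [sq_nonneg (z.re + (1/2) * (p.re + q.re) + (1/2) * (p.re + q.re)),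
      sq_nonneg (-z.im + (1/2) * (p.re + q.re) + (1/2) * (p.re + q.re)), sq_nonneg (p.re - q.re)]
  rcases lt_trichotomy k l with h | h | h
  · exact key k l h
  · subst h
    rw [gpb_of_eq, trace_mul_real hD (ketBra_posSemidef (b k)).1, Complex.norm_real,
      Real.norm_eq_abs, sq_abs]
    nlinarith [sq_nonneg (rtr (D * ketBra (b k) (b k)))]
  · have h1 := key l k h
    rw [← star_trace_mul_ketBra hD, norm_star] at h1
    linarith

theorem IsONB.complete_gpb : Complete (gpb b) := by
  intro H hH h0
  have h1 := hb.fnorm_compress_le H 1 isHermitian_one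
  have h2 : ∀ k l, ‖(H * ketBra (b l) (b k)).trace‖ = 0 := fun k l => by
    have := normSq_trace_mul_ketBra_le b hH k l
    simp only [h0] at this
    nlinarith [norm_nonneg (H * ketBra (b l) (b k)).trace]
  simp only [h2, mul_zero, Finset.sum_const_zero, Matrix.one_mul, Matrix.mul_one] at h1
  exact eq_zero_of_fnorm_eq_zero (le_antisymm h1 (fnorm_nonneg _))

omit hb in
/-- An eigenvector of an estimate of `P` lies almost in the kernel of `P`, or almost in its
support. -/
theorem kernel_weight_mul_le {A P E : Op d} {c : ℝ} (hA : IsEigenbasis A b) (hP : P.PosSemidef)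
    (hE : IsProj E) (hPE : P * E = 0) (hcP : (P * P - c • P).PosSemidef) (k : Fin d) :
    c * (fnorm (E * ketBra (b k) (b k)) ^ 2 * rtr (P * ketBra (b k) (b k))) ≤
      4 * fnorm (A - P) ^ 2 := by
  have hb : IsONB b := hA.orthonormal
  obtain ⟨μ, hμ⟩ := hA.eigen k
  have hB := hb.isProj k
  have hB1 := hb.fnorm_ketBra k k
  have hAB : A * ketBra (b k) (b k) = (μ : ℂ) • ketBra (b k) (b k) := by
    rw [ketBra, Matrix.mul_vecMulVec, hμ, Matrix.smul_vecMulVec]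
  set B := ketBra (b k) (b k)
  have hEP : E * P = 0 := by
    have := congrArg conjTranspose hPE
    rwa [conjTranspose_mul, hE.isHermitian.eq, hP.1.eq, conjTranspose_zero] at this
  have hη : fnorm ((A - P) * B) ≤ fnorm (A - P) := hB.fnorm_mul_le' _
  have h1 : |μ| * fnorm (E * B) ≤ fnorm (A - P) := by
    have e : E * ((A - P) * B) = (μ : ℂ) • (E * B) := by
      rw [Matrix.sub_mul, Matrix.mul_sub, hAB, ← Matrix.mul_assoc E P, hEP, Matrix.zero_mul,
        sub_zero, Matrix.mul_smul]
    have h := (hE.fnorm_mul_le ((A - P) * B)).trans hη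
    rwa [e, fnorm_smul, Complex.norm_real, Real.norm_eq_abs] at h
  have h2 : fnorm (P * B) ≤ |μ| + fnorm (A - P) := by
    have e : P * B = (μ : ℂ) • B - (A - P) * B := by
      rw [Matrix.sub_mul, hAB]; abel
    have h := fnorm_sub_le ((μ : ℂ) • B) ((A - P) * B)
    rw [← e, fnorm_smul, Complex.norm_real, Real.norm_eq_abs, hB1] at h
    linarith
  have hx0 := fnorm_nonneg (E * B)
  have hx1 : fnorm (E * B) ≤ 1 := hB1 ▸ hE.fnorm_mul_le B
  -- `h1` is useful for large `|μ|`, `h2` for small `|μ|`; multiplying `h2` by `‖E B‖ ≤ 1` and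
  -- inserting `h1` covers both without a case split.
  have h3 : fnorm (P * B) * fnorm (E * B) ≤ 2 * fnorm (A - P) := by
    have := fnorm_nonneg (A - P)
    nlinarith
  have h4 : c * rtr (P * B) ≤ fnorm (P * B) ^ 2 := by
    have h := rtr_mul_nonneg hcP hB.posSemidef
    rw [Matrix.sub_mul, Matrix.smul_mul, rtr_sub, rtr_smul] at h
    rw [hB.fnorm_sq_mul, hP.1.eq]
    linarith
  calc c * (fnorm (E * B) ^ 2 * rtr (P * B)) = c * rtr (P * B) * fnorm (E * B) ^ 2 := by ring
    _ ≤ fnorm (P * B) ^ 2 * fnorm (E * B) ^ 2 := by gcongr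
    _ = (fnorm (P * B) * fnorm (E * B)) ^ 2 := by ring
    _ ≤ (2 * fnorm (A - P)) ^ 2 :=
      pow_le_pow_left₀ (mul_nonneg (fnorm_nonneg _) hx0) h3 2
    _ = _ := by ring

end KetBra

/-! ### The second step -/

section StepTwo
variable {d n m : ℕ} {Ω : Fin d × Fin d → Op d} {P : Fin n → Op d} {b : Fin d → Fin d → ℂ}

/-- The first stage interpolates the frequencies, so the matrix element is a combination of four
frequency errors, each with variance controlled by the diagonal entries of `P i` at `k` and `l`. The
constant is not tight. -/
theorem expect_normSq_le (hΩ : IsOperatorBasis Ω) (hP : IsPOVM P) (hb : IsONB b) (hm : 0 < m)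
    (i : Fin n) (k l : Fin d) :
    expect P (gpb b) m (fun ω =>
      ‖((stageOne Ω (gpb b) ω i - P i) * ketBra (b l) (b k)).trace‖ ^ 2) ≤
      12 * (rtr (P i * ketBra (b k) (b k)) + rtr (P i * ketBra (b l) (b l))) / m := by
  have hs := hb.gpb_isState
  have h1 : ∀ a, expect P (gpb b) m (fun ω =>
      rtr ((stageOne Ω (gpb b) ω i - P i) * gpb b a) ^ 2) ≤
      (rtr (P i * ketBra (b a.1) (b a.1)) + rtr (P i * ketBra (b a.2) (b a.2))) / m := fun a => by
    simp only [rtr_stageOne_sub_mul hΩ hP hs hb.complete_gpb]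
    refine (expect_freq_sub_sq_le hP hs hm i a).trans ?_
    have := rtr_mul_gpb_le b (hP.posSemidef i) a
    rw [born_eq]
    gcongr
  refine (expect_mono hP hs fun ω => normSq_trace_mul_ketBra_le b
    ((stageOne_isHermitian hΩ ω i).sub (hP.posSemidef i).1) k l).trans ?_
  rw [expect_const_mul, expect_add, expect_add, expect_add]
  have a1 := h1 (k, l)
  have a2 := h1 (l, k)
  have a3 := h1 (k, k)
  have a4 := h1 (l, l)
  simp only at a1 a2 a3 a4
  have hp := rtr_mul_nonneg (hP.posSemidef i) (ketBra_posSemidef (b k))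
  have hq := rtr_mul_nonneg (hP.posSemidef i) (ketBra_posSemidef (b l))
  have hm' : (0 : ℝ) < m := by exact_mod_cast hm
  generalize rtr (P i * ketBra (b k) (b k)) = p at *
  generalize rtr (P i * ketBra (b l) (b l)) = q at *
  have hpm : 0 ≤ p / m := by positivity
  have hqm : 0 ≤ q / m := by positivity
  have e : 12 * (p + q) / m = 12 * (p / m) + 12 * (q / m) := by ring
  rw [add_div] at a1 a2 a3 a4
  rw [e]
  linarith

/-- The constant must not depend on `b`, which is random in Step 2. For this reason the bound comes
from matrix elements and not from `exists_stageOne_error_le`, whose constant depends on the probe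
states. -/
theorem expect_stageOne_error_le (hΩ : IsOperatorBasis Ω) (hP : IsPOVM P) (hb : IsONB b)
    (hm : 0 < m) (i : Fin n) :
    expect P (gpb b) m (fun ω => fnorm (stageOne Ω (gpb b) ω i - P i) ^ 2) ≤
      24 * d ^ 4 / m := by
  have hs := hb.gpb_isState
  have hm' : (0 : ℝ) < m := by exact_mod_cast hm
  have hp1 : ∀ k, rtr (P i * ketBra (b k) (b k)) ≤ 1 := fun k => by
    have h1 := sum_born hP (hs (k, k))
    rw [← h1, ← gpb_of_eq, ← born_eq]
    exact Finset.single_le_sum (f := fun i => born P (gpb b (k, k)) i)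
      (fun i _ => born_nonneg hP (hs (k, k)) i) (Finset.mem_univ i)
  have h1 : ∀ ω : Data (Fin d × Fin d) m n, fnorm (stageOne Ω (gpb b) ω i - P i) ^ 2 ≤
      d ^ 2 * ∑ x : Fin d × Fin d,
        ‖((stageOne Ω (gpb b) ω i - P i) * ketBra (b x.2) (b x.1)).trace‖ ^ 2 := fun ω => by
    have h2 := hb.fnorm_compress_le (stageOne Ω (gpb b) ω i - P i) 1 isHermitian_one
    simp only [Matrix.mul_one, one_mul, hb.fnorm_ketBra] at h2
    rw [← Fintype.sum_prod_type'
      (f := fun k l => ‖((stageOne Ω (gpb b) ω i - P i) * ketBra (b l) (b k)).trace‖)] at h2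
    refine (pow_le_pow_left₀ (fnorm_nonneg _) h2 2).trans (sq_sum_le_card_mul_sum_sq.trans ?_)
    simp [sq]
  refine (expect_mono hP hs h1).trans ?_
  rw [expect_const_mul, expect_sum]
  have h3 : ∀ x : Fin d × Fin d, expect P (gpb b) m (fun ω =>
      ‖((stageOne Ω (gpb b) ω i - P i) * ketBra (b x.2) (b x.1)).trace‖ ^ 2) ≤ 24 / m := fun x => by
    refine (expect_normSq_le hΩ hP hb hm i x.1 x.2).trans ?_
    gcongr
    linarith [hp1 x.1, hp1 x.2]
  calc _ ≤ (d : ℝ) ^ 2 * ∑ x : Fin d × Fin d, 24 / (m : ℝ) := by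
        gcongr with x; exact h3 x
    _ = _ := by simp; ring

/-- The heart of the adaptive gain: matrix elements with large variance belong to basis vectors with
large `p_k`, and these have little weight in the kernel. -/
theorem expect_kernel_error_le (hΩ : IsOperatorBasis Ω) (hP : IsPOVM P) {A E : Op d} {c : ℝ}
    (hA : IsEigenbasis A b) (hm : 0 < m) {i : Fin n} (hE : IsProj E) (hPE : P i * E = 0)
    (hc : 0 < c) (hcP : (P i * P i - c • P i).PosSemidef) :
    expect P (gpb b) m (fun ω => fnorm (E * (stageOne Ω (gpb b) ω i - P i) * E)) ≤
      d ^ 2 * (1 / m + 48 / c * fnorm (A - P i) ^ 2) := by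
  have hb : IsONB b := hA.orthonormal
  have hs := hb.gpb_isState
  have hm' : (0 : ℝ) < m := by exact_mod_cast hm
  have hx0 : ∀ k, 0 ≤ fnorm (E * ketBra (b k) (b k)) := fun k => fnorm_nonneg _
  have hx1 : ∀ k, fnorm (E * ketBra (b k) (b k)) ≤ 1 := fun k =>
    (hE.fnorm_mul_le _).trans (hb.fnorm_ketBra k k).le
  have hw : ∀ k, fnorm (E * ketBra (b k) (b k)) ^ 2 * rtr (P i * ketBra (b k) (b k)) ≤
      4 / c * fnorm (A - P i) ^ 2 := fun k => by
    have := kernel_weight_mul_le hA (hP.posSemidef i) hE hPE hcP k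
    rw [div_mul_eq_mul_div, le_div_iff₀ hc]
    linarith
  have hp : ∀ k, 0 ≤ rtr (P i * ketBra (b k) (b k)) := fun k =>
    rtr_mul_nonneg (hP.posSemidef i) (ketBra_posSemidef (b k))
  refine (expect_mono hP hs fun ω => hb.fnorm_compress_le _ _ hE.isHermitian).trans ?_
  simp only [expect_sum]
  have key : ∀ k l, expect P (gpb b) m (fun ω => fnorm (E * ketBra (b k) (b k)) *
      fnorm (E * ketBra (b l) (b l)) *
        ‖((stageOne Ω (gpb b) ω i - P i) * ketBra (b l) (b k)).trace‖) ≤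
      1 / m + 48 / c * fnorm (A - P i) ^ 2 := fun k l => by
    set t := fnorm (E * ketBra (b k) (b k)) * fnorm (E * ketBra (b l) (b l)) with ht
    -- AM-GM with weight `m`, matched to the order `1/m` of the second moment of `z`: the factors
    -- `m` cancel and leave `t² (p_k + p_l)`.
    have h1 : ∀ z : ℝ, t * z ≤ 1 / (2 * m) + (m * t ^ 2 / 2) * z ^ 2 := fun z => by
      have : 1 / (2 * m) + (m * t ^ 2 / 2) * z ^ 2 - t * z = (1 - m * t * z) ^ 2 / (2 * m) := by
        field_simp; ring
      have h2 : 0 ≤ (1 - m * t * z) ^ 2 / (2 * m) := by positivity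
      linarith
    refine (expect_mono hP hs fun ω => h1 _).trans ?_
    rw [expect_add, expect_const hP hs, expect_const_mul]
    have h3 := mul_le_mul_of_nonneg_left (expect_normSq_le hΩ hP hb hm i k l)
      (by positivity : 0 ≤ m * t ^ 2 / 2)
    have h4 : t ^ 2 * (rtr (P i * ketBra (b k) (b k)) + rtr (P i * ketBra (b l) (b l))) ≤
        8 / c * fnorm (A - P i) ^ 2 := by
      have hk := hw k
      have hl := hw l
      have hk1 := pow_le_one₀ (n := 2) (hx0 k) (hx1 k)
      have hl1 := pow_le_one₀ (n := 2) (hx0 l) (hx1 l)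
      have a1 := mul_le_of_le_one_right (mul_nonneg (sq_nonneg (fnorm (E * ketBra (b k) (b k))))
        (hp k)) hl1
      have a2 := mul_le_of_le_one_right (mul_nonneg (sq_nonneg (fnorm (E * ketBra (b l) (b l))))
        (hp l)) hk1
      have e : 8 / c * fnorm (A - P i) ^ 2 = 2 * (4 / c * fnorm (A - P i) ^ 2) := by ring
      rw [ht, mul_pow, e]
      linarith
    have e2 : m * t ^ 2 / 2 * (12 * (rtr (P i * ketBra (b k) (b k)) +
        rtr (P i * ketBra (b l) (b l))) / m) = 6 * (t ^ 2 * (rtr (P i * ketBra (b k) (b k)) +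
        rtr (P i * ketBra (b l) (b l)))) := by field_simp; ring
    rw [e2] at h3
    have h5 : 1 / (2 * (m : ℝ)) ≤ 1 / m := by
      apply one_div_le_one_div_of_le hm'; linarith
    have e3 : 48 / c * fnorm (A - P i) ^ 2 = 6 * (8 / c * fnorm (A - P i) ^ 2) := by ring
    rw [e3]
    linarith
  calc _ ≤ ∑ k : Fin d, ∑ l : Fin d, (1 / (m : ℝ) + 48 / c * fnorm (A - P i) ^ 2) :=
        Finset.sum_le_sum fun k _ => Finset.sum_le_sum fun l _ => key k l
    _ = _ := by simp; ring

/-- Expected infidelity of the second step, in terms of the error of the first. -/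
theorem exists_stepTwo_bound (hd : 1 ≤ d) (hΩ : IsOperatorBasis Ω) (hP : IsPOVM P) {i : Fin n}
    (h0 : P i ≠ 0) : ∃ C : ℝ, 0 ≤ C ∧ ∀ (A : Op d) (b : Fin d → Fin d → ℂ), IsEigenbasis A b →
      ∀ m : ℕ, 0 < m → expect P (gpb b) m (fun ω =>
        infidelity (twoStage Ω (gpb b) ω i) (P i)) ≤ C * (1 / m + frobSq (A - P i)) := by
  -- `E` and `c` depend on `P i` alone, which makes the constant uniform in the Step 1 estimate, its
  -- eigenbasis and `m`.
  obtain ⟨E, c, hE, hPE, hc, hcE, hcP⟩ := exists_kernel_proj (hP.posSemidef i)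
  obtain ⟨C, hC, h⟩ := exists_infidelity_stageTwo_le hd hP h0 hE hPE hc hcE
  refine ⟨C * (n * (24 * d ^ 4) + d ^ 2 * (1 + 48 / c)), by positivity, fun A b hA m hm => ?_⟩
  have hb : IsONB b := hA.orthonormal
  have hs := hb.gpb_isState
  refine (expect_mono hP hs fun ω => h _ fun k => stageOne_isHermitian hΩ ω k).trans ?_
  rw [expect_const_mul, expect_add, expect_sum, frobSq_eq, mul_assoc]
  refine mul_le_mul_of_nonneg_left ?_ hC
  have h1 : ∑ k, expect P (gpb b) m (fun ω => fnorm (stageOne Ω (gpb b) ω k - P k) ^ 2) ≤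
      n * (24 * d ^ 4) * (1 / m) := by
    calc _ ≤ ∑ k : Fin n, 24 * (d : ℝ) ^ 4 / m :=
          Finset.sum_le_sum fun k _ => expect_stageOne_error_le hΩ hP hb hm k
      _ = _ := by simp; ring
  have h2 := expect_kernel_error_le hΩ hP hA hm hE hPE hc hcP
  refine (add_le_add h1 h2).trans ?_
  have hx : 0 ≤ fnorm (A - P i) ^ 2 := sq_nonneg _
  have hy : 0 ≤ 1 / (m : ℝ) := by positivity
  generalize fnorm (A - P i) ^ 2 = x at *
  generalize 1 / (m : ℝ) = y at *
  have e1 : 0 ≤ n * (24 * (d : ℝ) ^ 4) * x := by positivity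
  have e2 : 0 ≤ (d : ℝ) ^ 2 * (48 / c) * y := by positivity
  have e3 : 0 ≤ (d : ℝ) ^ 2 * x := by positivity
  linarith

end StepTwo

/-! ### The rate of the two-step procedure -/

section Rate
variable {d n : ℕ} {Ω : Fin d × Fin d → Op d} {P : Fin n → Op d}

theorem mse_nonneg {J : Type} [Fintype J] [DecidableEq J] {ρ : J → Op d} (hP : IsPOVM P)
    (hρ : ∀ j, IsState (ρ j)) (m : ℕ) (A : Data J m n → Fin n → Op d) (i : Fin n) :
    0 ≤ mse P ρ m A i :=
  expect_nonneg hP hρ fun ω => by rw [frobSq_eq]; exact sq_nonneg _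

theorem mse_twoStage_isBigO {J : Type} [Fintype J] [DecidableEq J] {ρ : J → Op d}
    (hΩ : IsOperatorBasis Ω) (hρ : ∀ j, IsState (ρ j)) (hc : Complete ρ) (hP : IsPOVM P)
    (i : Fin n) :
    (fun m : ℕ => mse P ρ m (fun ω => twoStage Ω ρ ω) i) =O[atTop] fun m : ℕ => 1 / (m : ℝ) := by
  obtain ⟨C₁, hC₁, h₁⟩ := exists_stageTwo_bound hP i
  obtain ⟨C₂, hC₂, h₂⟩ := exists_stageOne_error_le (n := n) hΩ hρ hc
  refine IsBigO.of_bound (C₁ * (n * (C₂ * Fintype.card J))) ?_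
  filter_upwards [eventually_gt_atTop 0] with m hm
  have hm' : (0 : ℝ) < m := by exact_mod_cast hm
  rw [Real.norm_of_nonneg (mse_nonneg hP hρ _ _ _), Real.norm_of_nonneg (by positivity)]
  have hborn : ∀ k j, born P (ρ j) k ≤ 1 := fun k j => by
    rw [← sum_born hP (hρ j)]
    exact Finset.single_le_sum (f := fun k => born P (ρ j) k)
      (fun k _ => born_nonneg hP (hρ j) k) (Finset.mem_univ k)
  have hk : ∀ k, expect P ρ m (fun ω => fnorm (stageOne Ω ρ ω k - P k) ^ 2) ≤
      C₂ * Fintype.card J * (1 / m) := fun k => by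
    refine (expect_mono hP hρ fun ω => h₂ P hP m ω k).trans ?_
    rw [expect_const_mul, expect_sum, mul_assoc]
    refine mul_le_mul_of_nonneg_left ?_ hC₂
    calc _ ≤ ∑ j : J, 1 / (m : ℝ) := Finset.sum_le_sum fun j _ =>
          (expect_freq_sub_sq_le hP hρ hm k j).trans
            (div_le_div_of_nonneg_right (hborn k j) hm'.le)
      _ = _ := by simp
  calc mse P ρ m (fun ω => twoStage Ω ρ ω) i
      ≤ expect P ρ m (fun ω => C₁ * ∑ k, fnorm (stageOne Ω ρ ω k - P k) ^ 2) :=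
        expect_mono hP hρ fun ω => by
          rw [frobSq_eq]; exact h₁ _ fun k => stageOne_isHermitian hΩ ω k
    _ ≤ C₁ * ∑ k : Fin n, C₂ * Fintype.card J * (1 / m) := by
        rw [expect_const_mul, expect_sum]
        exact mul_le_mul_of_nonneg_left (Finset.sum_le_sum fun k _ => hk k) hC₁
    _ = _ := by simp; ring

/-- Handles the roundings of both steps: the `+ 1` allows for the floor in `N₀`, and the natural
division loses at most one more copy per state. -/
theorem tendsto_and_isBigO_div {f : ℕ → ℕ} {c : ℝ} (hc : 0 < c) (hf : ∀ N, c * N ≤ f N + 1) {k : ℕ}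
    (hk : 0 < k) : Tendsto (fun N => f N / k) atTop atTop ∧
      (fun N => 1 / ((f N / k : ℕ) : ℝ)) =O[atTop] fun N : ℕ => 1 / (N : ℝ) := by
  have hk' : (0 : ℝ) < k := by exact_mod_cast hk
  have h1 : ∀ N, c / k * N - 2 ≤ ((f N / k : ℕ) : ℝ) := fun N => by
    have h2 : (f N : ℝ) + 1 ≤ k * (f N / k : ℕ) + k := by
      have := Nat.lt_mul_div_succ (f N) hk
      have h3 : f N + 1 ≤ k * (f N / k) + k := by
        rw [Nat.mul_add] at this; omega
      exact_mod_cast h3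
    have h4 : c * N / k ≤ (f N / k : ℕ) + 1 := by
      rw [div_le_iff₀ hk']
      linarith [hf N]
    have e : c / k * N = c * N / k := by ring
    linarith
  have ht : Tendsto (fun N : ℕ => c / k * (N : ℝ) - 2) atTop atTop :=
    tendsto_atTop_add_const_right _ _ (tendsto_natCast_atTop_atTop.const_mul_atTop (by positivity))
  refine ⟨tendsto_natCast_atTop_iff (R := ℝ) |>.mp (tendsto_atTop_mono h1 ht), ?_⟩
  refine IsBigO.of_bound (2 * k / c) ?_
  -- Beyond this threshold the loss of `2` in `h1` is at most half of `c N / k`.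
  have h5 : ∀ᶠ N : ℕ in atTop, (4 * k / c : ℝ) ≤ N :=
    tendsto_natCast_atTop_atTop.eventually_ge_atTop _
  filter_upwards [h5, eventually_gt_atTop 0] with N hN hN0
  have hN' : (0 : ℝ) < N := by exact_mod_cast hN0
  rw [Real.norm_of_nonneg (by positivity), Real.norm_of_nonneg (by positivity)]
  have h6 : c / k * N / 2 ≤ ((f N / k : ℕ) : ℝ) := by
    have h7 : 4 ≤ c / k * N := by
      rw [div_le_iff₀ hc] at hN
      rw [div_mul_eq_mul_div, le_div_iff₀ hk']
      linarith
    linarith [h1 N]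
  have h8 : (0 : ℝ) < c / k * N / 2 := by positivity
  calc 1 / ((f N / k : ℕ) : ℝ) ≤ 1 / (c / k * N / 2) := one_div_le_one_div_of_le h8 h6
    _ = _ := by field_simp

/-- Given the Step 1 data, `exists_stepTwo_bound` applies with a fixed constant. Averaging it over
Step 1 turns the squared error into the mean squared error assumed to be `O(1/m)`. -/
theorem adaptiveInfidelity_isBigO {M : ℕ} (hd : 1 ≤ d) (hΩ : IsOperatorBasis Ω)
    {ρ : Fin M → Op d} (hρ : ∀ j, IsState (ρ j)) (hM : 0 < M) (hP : IsPOVM P) {i : Fin n}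
    (h0 : P i ≠ 0) (A : (m : ℕ) → Data (Fin M) m n → Fin n → Op d)
    (b : (m : ℕ) → Data (Fin M) m n → Fin d → Fin d → ℂ) {α : ℝ}
    (hmse : (fun m : ℕ => mse P ρ m (A m) i) =O[atTop] fun m : ℕ => 1 / (m : ℝ))
    (hb : ∀ m ω, IsEigenbasis (A m ω i) (b m ω)) (hα : 0 < α) (hα1 : α < 1) :
    (fun N : ℕ => adaptiveInfidelity Ω P i ρ (⌊α * N⌋₊ / M) ((N - ⌊α * N⌋₊) / d ^ 2)
      (b (⌊α * N⌋₊ / M))) =O[atTop] fun N : ℕ => 1 / (N : ℝ) := by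
  obtain ⟨C, hC, h⟩ := exists_stepTwo_bound hd hΩ hP h0
  obtain ⟨ht₁, hO₁⟩ := tendsto_and_isBigO_div (f := fun N => ⌊α * N⌋₊) hα
    (fun N => (Nat.lt_floor_add_one _).le) hM
  obtain ⟨ht₂, hO₂⟩ := tendsto_and_isBigO_div (f := fun N => N - ⌊α * N⌋₊) (c := 1 - α)
    (by linarith) (fun N => by
      have h1 : (⌊α * N⌋₊ : ℝ) ≤ α * N := Nat.floor_le (by positivity)
      have h2 : ⌊α * (N : ℝ)⌋₊ ≤ N := by
        apply Nat.floor_le_of_le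
        nlinarith [Nat.cast_nonneg (α := ℝ) N]
      rw [Nat.cast_sub h2]
      linarith) (k := d ^ 2) (by positivity)
  have hO := (hO₂.add ((hmse.comp_tendsto ht₁).trans hO₁)).const_mul_left C
  refine IsBigO.trans (IsBigO.of_bound 1 ?_) hO
  filter_upwards [ht₂.eventually_gt_atTop 0] with N hN
  simp only [Function.comp]
  rw [one_mul]
  refine (Real.norm_of_nonneg ?_).trans_le (le_trans ?_ (Real.le_norm_self _))
  · refine expect_nonneg hP hρ fun ω => ?_
    have ho : IsONB (b _ ω) := (hb _ ω).orthonormal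
    exact expect_nonneg hP ho.gpb_isState fun ω₂ =>
      infidelity_nonneg (hP.posSemidef i) (stageTwo_posSemidef _ _)
  · refine (expect_mono hP hρ fun ω => h _ _ (hb _ ω) _ hN).trans ?_
    rw [expect_const_mul, expect_add, expect_const hP hρ]
    rfl

end Rate

/-! ### Optimality -/

section Optimality
variable {n : ℕ}

/-- Distribution of a coin with faces `i` and `i'`. -/
def coin (i i' : Fin n) (p : ℝ) (k : Fin n) : ℝ :=
  if k = i then p else if k = i' then 1 - p else 0

variable {i i' : Fin n}

theorem coin_nonneg {p : ℝ} (h0 : 0 ≤ p) (h1 : p ≤ 1) (k : Fin n) : 0 ≤ coin i i' p k := by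
  unfold coin; split_ifs <;> linarith

/-- The condition `f 0 0 = 0` removes the impossible faces; it holds for `x² / y` because `0 / 0 =
0`. -/
theorem sum_coin_mul (h : i' ≠ i) (f : ℝ → ℝ → ℝ) (hf : f 0 0 = 0) (p q : ℝ) :
    ∑ k, f (coin i i' p k) (coin i i' q k) = f p q + f (1 - p) (1 - q) := by
  rw [Finset.sum_eq_add i i' h.symm]
  · simp [coin, h]
  · intro k _ hk
    simp [coin, hk.1, hk.2, hf]
  · simp
  · simp

theorem sum_coin (h : i' ≠ i) (p : ℝ) : ∑ k, coin i i' p k = 1 := by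
  have := sum_coin_mul h (fun x _ => x) rfl p p
  simpa using this

theorem continuous_coin (k : Fin n) : Continuous fun p => coin i i' p k := by
  unfold coin; split_ifs <;> fun_prop

/-- Mean squared error of an estimate of the bias of a coin from `N` tosses. -/
def coinRisk (i i' : Fin n) {N : ℕ} (q : (Fin N → Fin n) → ℝ) (p : ℝ) : ℝ :=
  ∑ ω : Fin N → Fin n, (∏ k, coin i i' p (ω k)) * (q ω - p) ^ 2

theorem continuous_coinRisk {N : ℕ} (q : (Fin N → Fin n) → ℝ) :
    Continuous (coinRisk i i' q) := by
  unfold coinRisk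
  refine continuous_finsetSum _ fun ω _ => Continuous.mul ?_ (by fun_prop)
  exact continuous_finsetProd _ fun k _ => continuous_coin (ω k)

/-- Two-point bound for the risk, through the chi-square divergence. -/
theorem sq_sub_le_coinRisk (h : i' ≠ i) {N : ℕ} (q : (Fin N → Fin n) → ℝ) {a b : ℝ}
    (ha0 : 0 < a) (ha1 : a < 1) (hb0 : 0 ≤ b) (hb1 : b ≤ 1) :
    (b - a) ^ 2 ≤ 2 * ((1 + (b - a) ^ 2 / (a * (1 - a))) ^ N * coinRisk i i' q a)
      + 2 * coinRisk i i' q b := by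
  set La : (Fin N → Fin n) → ℝ := fun ω => ∏ k, coin i i' a (ω k) with hLa
  set Lb : (Fin N → Fin n) → ℝ := fun ω => ∏ k, coin i i' b (ω k) with hLb
  have hLa0 : ∀ ω, 0 ≤ La ω := fun ω => Finset.prod_nonneg fun k _ => coin_nonneg ha0.le ha1.le _
  have hLb0 : ∀ ω, 0 ≤ Lb ω := fun ω => Finset.prod_nonneg fun k _ => coin_nonneg hb0 hb1 _
  have hsum : ∑ ω, Lb ω = 1 := by
    simp only [hLb]
    rw [sum_prod_apply fun _ x => coin i i' b x]
    simp [sum_coin h]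
  -- Second moment of the likelihood ratio, which factors over the tosses.
  have hchi : ∑ ω, Lb ω ^ 2 / La ω = (1 + (b - a) ^ 2 / (a * (1 - a))) ^ N := by
    have e : ∀ ω, Lb ω ^ 2 / La ω = ∏ k, (coin i i' b (ω k) ^ 2 / coin i i' a (ω k)) := fun ω => by
      simp only [hLa, hLb, Finset.prod_div_distrib, Finset.prod_pow]
    simp only [e]
    rw [sum_prod_apply fun _ x => coin i i' b x ^ 2 / coin i i' a x]
    rw [Finset.prod_const, Finset.card_univ, Fintype.card_fin,
      sum_coin_mul h (fun x y => x ^ 2 / y) (by simp)]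
    have h1 : 1 - a ≠ 0 := by linarith
    congr 1
    field_simp
    ring
  -- Absolute continuity: without it the convention `x / 0 = 0` would lose mass in the
  -- Cauchy–Schwarz step.
  have hzero : ∀ ω, La ω = 0 → Lb ω = 0 := fun ω h0 => by
    obtain ⟨k, -, hk⟩ := Finset.prod_eq_zero_iff.mp h0
    refine Finset.prod_eq_zero (Finset.mem_univ k) ?_
    unfold coin at hk ⊢
    split_ifs at hk ⊢
    · exact absurd hk ha0.ne'
    · linarith
    · rfl
  have h1 : (∑ ω, Lb ω * (q ω - a)) ^ 2 ≤
      (1 + (b - a) ^ 2 / (a * (1 - a))) ^ N * coinRisk i i' q a := by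
    rw [← hchi]
    refine Finset.sum_sq_le_sum_mul_sum_of_sq_le_mul _ (fun ω _ => ?_) (fun ω _ => ?_)
      (fun ω _ => ?_)
    · exact div_nonneg (sq_nonneg _) (hLa0 ω)
    · exact mul_nonneg (hLa0 ω) (sq_nonneg _)
    · refine le_of_eq ?_
      change _ = Lb ω ^ 2 / La ω * (La ω * (q ω - a) ^ 2)
      rcases eq_or_ne (La ω) 0 with h0 | h0
      · simp [h0, hzero ω h0]
      · field_simp
  have h2 : (∑ ω, Lb ω * (q ω - b)) ^ 2 ≤ coinRisk i i' q b := by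
    have h3 : (∑ ω, Lb ω * (q ω - b)) ^ 2 ≤ (∑ ω, Lb ω) * coinRisk i i' q b := by
      refine Finset.sum_sq_le_sum_mul_sum_of_sq_le_mul _ (fun ω _ => hLb0 ω) (fun ω _ => ?_)
        (fun ω _ => ?_)
      · exact mul_nonneg (hLb0 ω) (sq_nonneg _)
      · refine le_of_eq ?_
        change _ = Lb ω * (Lb ω * (q ω - b) ^ 2)
        ring
    rwa [hsum, one_mul] at h3
  have e : b - a = ∑ ω, Lb ω * (q ω - a) - ∑ ω, Lb ω * (q ω - b) := by
    rw [← Finset.sum_sub_distrib]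
    calc b - a = (b - a) * ∑ ω, Lb ω := by rw [hsum, mul_one]
      _ = _ := by
        rw [Finset.mul_sum]
        exact Finset.sum_congr rfl fun ω _ => by ring
  have h4 : (b - a) ^ 2 ≤
      2 * (∑ ω, Lb ω * (q ω - a)) ^ 2 + 2 * (∑ ω, Lb ω * (q ω - b)) ^ 2 := by
    rw [e]
    nlinarith [sq_nonneg (∑ ω, Lb ω * (q ω - a) + ∑ ω, Lb ω * (q ω - b))]
  linarith

/-- No sequence of estimates of the bias of a coin has mean squared error `o(1 / N)` at every
bias. -/
theorem exists_not_isLittleO_coinRisk (h : i' ≠ i) (q : (N : ℕ) → (Fin N → Fin n) → ℝ) :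
    ∃ p : ℝ, 0 < p ∧ p < 1 ∧
      ¬ (fun N => coinRisk i i' (q N) p) =o[atTop] fun N : ℕ => 1 / (N : ℝ) := by
  by_contra! hcon
  set K := Set.Icc (1 / 4 : ℝ) (3 / 4)
  -- Chosen so that the two-point bound with both risks at most `ε/N` reads `1/N ≤ 1/(2N)`. The
  -- exponent `16/3` comes from `p (1 - p) ≥ 3/16` on `K`.
  set ε : ℝ := 1 / (4 * (Real.exp (16 / 3) + 1)) with hε
  have hε0 : 0 < ε := by positivity
  have hcl : ∀ m : ℕ, IsClosed {p : K | ∀ N : ℕ, m ≤ N → coinRisk i i' (q N) p ≤ ε * (1 / N)} := by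
    intro m
    simp only [Set.ofPred_forall]
    refine isClosed_iInter fun N => isClosed_iInter fun _ => ?_
    exact isClosed_le ((continuous_coinRisk (q N)).comp continuous_subtype_val) continuous_const
  have hun : ⋃ m : ℕ, {p : K | ∀ N : ℕ, m ≤ N → coinRisk i i' (q N) p ≤ ε * (1 / N)}
      = Set.univ := by
    refine Set.eq_univ_of_forall fun p => ?_
    have hp := p.2
    have := (hcon p (by linarith [hp.1]) (by linarith [hp.2])).def hε0
    obtain ⟨m, hm⟩ := eventually_atTop.mp this
    refine Set.mem_iUnion.mpr ⟨m, fun N hN => ?_⟩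
    have h1 := (Real.le_norm_self _).trans (hm N hN)
    rwa [Real.norm_of_nonneg (by positivity : (0 : ℝ) ≤ 1 / N)] at h1
  have : Nonempty K := ⟨⟨1 / 2, by constructor <;> norm_num⟩⟩
  -- Baire: on some ball of biases, the bound `ε/N` holds uniformly from `m` on.
  obtain ⟨m, p, hp⟩ := nonempty_interior_of_iUnion_of_closed hcl hun
  obtain ⟨r, hr, hball⟩ := Metric.mem_nhds_iff.mp (mem_interior_iff_mem_nhds.mp hp)
  -- The sample size is `N = L²` and the second bias lies at distance `1/L = 1/√N`. The three bounds
  -- on `L` keep it in the ball, keep it in `K`, and ensure `N ≥ m`.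
  obtain ⟨L, hL⟩ := exists_nat_gt (max (1 / r) (max 4 m))
  have hL1 : 1 / r < L := (le_max_left _ _).trans_lt hL
  have hL2 : (4 : ℝ) < L := ((le_max_left _ _).trans (le_max_right _ _)).trans_lt hL
  have hL3 : m < L := by
    exact_mod_cast ((le_max_right _ _).trans (le_max_right _ _)).trans_lt hL
  have hL0 : (0 : ℝ) < L := by linarith
  have hN : m ≤ L ^ 2 := hL3.le.trans (Nat.le_self_pow two_ne_zero L)
  obtain ⟨hp1, hp2⟩ := p.2
  have hδr : 1 / (L : ℝ) < r := by
    rw [div_lt_iff₀ hL0]; rw [div_lt_iff₀ hr] at hL1; linarith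
  have hδ4 : 1 / (L : ℝ) < 1 / 4 := one_div_lt_one_div_of_lt (by norm_num) hL2
  have hδ0 : 0 < 1 / (L : ℝ) := by positivity
  obtain ⟨b, hbK, hbp⟩ : ∃ b : ℝ, b ∈ K ∧ |b - p| = 1 / L := by
    rcases le_total (p : ℝ) (1 / 2) with hp' | hp'
    · refine ⟨p + 1 / L, ⟨by linarith, by linarith⟩, ?_⟩
      rw [add_sub_cancel_left, abs_of_pos hδ0]
    · refine ⟨p - 1 / L, ⟨by linarith, by linarith⟩, ?_⟩
      rw [sub_sub_cancel_left, abs_neg, abs_of_pos hδ0]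
  have hRa := hball (Metric.mem_ball_self hr) (L ^ 2) hN
  have hbB : (⟨b, hbK⟩ : K) ∈ Metric.ball p r := by
    rw [Metric.mem_ball, Subtype.dist_eq, Real.dist_eq, hbp]; exact hδr
  have hRb := hball hbB (L ^ 2) hN
  have hsq : (b - p) ^ 2 = 1 / ((L ^ 2 : ℕ) : ℝ) := by
    rw [← sq_abs, hbp]; push_cast; rw [div_pow, one_pow]
  have hmain := sq_sub_le_coinRisk h (q (L ^ 2)) (a := p) (b := b) (by linarith) (by linarith)
    (by linarith [hbK.1]) (by linarith [hbK.2])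
  have hchi : (1 + (b - p) ^ 2 / (p * (1 - p))) ^ (L ^ 2) ≤ Real.exp (16 / 3) := by
    have h1 : (3 / 16 : ℝ) ≤ p * (1 - p) := by nlinarith
    have h2 : (b - p) ^ 2 / (p * (1 - p)) ≤ 16 / 3 * (b - p) ^ 2 := by
      rw [div_le_iff₀ (by linarith)]
      nlinarith [sq_nonneg (b - p)]
    have h3 : 1 + (b - p) ^ 2 / (p * (1 - p)) ≤ Real.exp (16 / 3 * (b - p) ^ 2) := by
      linarith [Real.add_one_le_exp (16 / 3 * (b - p) ^ 2)]
    have h4 : 0 ≤ (b - p) ^ 2 / ((p : ℝ) * (1 - p)) := div_nonneg (sq_nonneg _) (by linarith)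
    calc _ ≤ Real.exp (16 / 3 * (b - p) ^ 2) ^ (L ^ 2) := pow_le_pow_left₀ (by linarith) h3 _
      _ = Real.exp (16 / 3) := by
        rw [← Real.exp_nat_mul, hsq]
        congr 1
        push_cast
        field_simp
  rw [hsq] at hmain
  rw [hsq] at hchi
  set δ : ℝ := 1 / ((L ^ 2 : ℕ) : ℝ) with hδ
  have hδpos : 0 < δ := by rw [hδ]; push_cast; positivity
  have hexp := Real.exp_pos (16 / 3)
  have h5 := mul_le_mul hchi hRa (Finset.sum_nonneg fun ω _ => mul_nonneg (Finset.prod_nonneg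
    fun k _ => coin_nonneg (by linarith) (by linarith) _) (sq_nonneg _)) hexp.le
  have h6 : 2 * (Real.exp (16 / 3) * (ε * δ)) + 2 * (ε * δ) = δ / 2 := by
    rw [hε]; field_simp; ring
  simp only at hRb
  linarith

theorem coin_isPOVM {d : ℕ} (h : i' ≠ i) {p : ℝ} (h0 : 0 ≤ p) (h1 : p ≤ 1) :
    IsPOVM fun k => coin i i' p k • (1 : Op d) := by
  refine ⟨fun k => PosSemidef.one.smul (coin_nonneg h0 h1 k), ?_⟩
  rw [← Finset.sum_smul, sum_coin h, one_smul]

/-- For multiples of the identity the outcome law does not depend on the state, so any adaptive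
strategy only tosses a coin; the trace term of the infidelity is exactly the squared error of `Tr Q
/ d`. -/
theorem coinRisk_le_sequentialInfidelity {d N : ℕ} (hd : 1 ≤ d) (h : i' ≠ i) {p : ℝ} (h0 : 0 ≤ p)
    (h1 : p ≤ 1) {σ : List (Fin n) → Op d} {Q : (Fin N → Fin n) → Op d} (hσ : ∀ l, IsState (σ l))
    (hQ : ∀ ω, (Q ω).PosSemidef) :
    coinRisk i i' (fun ω => rtr (Q ω) / d) p ≤
      sequentialInfidelity (fun k => coin i i' p k • (1 : Op d)) i N σ Q := by
  have hd' : (0 : ℝ) < d := by exact_mod_cast hd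
  refine Finset.sum_le_sum fun ω _ => ?_
  have e : sequentialProb (fun k => coin i i' p k • (1 : Op d)) σ ω =
      ∏ k, coin i i' p (ω k) := by
    refine Finset.prod_congr rfl fun k _ => ?_
    rw [born_eq, Matrix.smul_mul, Matrix.one_mul, rtr_smul, rtr, (hσ _).trace_eq_one,
      Complex.one_re, mul_one]
  rw [e]
  refine mul_le_mul_of_nonneg_left ?_ (Finset.prod_nonneg fun k _ => coin_nonneg h0 h1 _)
  refine le_trans (le_of_eq ?_) (le_infidelity ((coin_isPOVM h h0 h1).posSemidef i) (hQ ω))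
  simp [coin]
  field_simp
  ring

end Optimality

end QDT
end

theorem corollary1 (d n M : ℕ) (hd : 1 ≤ d) (hn : 2 ≤ n)
    (Ω : Fin d × Fin d → Op d) (hΩ : IsOperatorBasis Ω)
    (ρ : Fin M → Op d) (hρ : ∀ j, IsState (ρ j)) (hcomplete : SpansHermitian ρ) (i : Fin n) :
    -- the two-step procedure reaches the rate 1 / N at every POVM
    (∀ P : Fin n → Op d, IsPOVM P → P i ≠ 0 →
      -- the two-stage algorithm is admissible in Step 1
      ((fun m : ℕ => mse P ρ m (fun ω => twoStage Ω ρ ω) i)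
        =O[atTop] fun m : ℕ => 1 / (m : ℝ)) ∧
      -- every algorithm in Step 1 with mean squared error O(1 / m) will do
      ∀ (A : (m : ℕ) → Data (Fin M) m n → Fin n → Op d)
        (b : (m : ℕ) → Data (Fin M) m n → Fin d → Fin d → ℂ) (α : ℝ),
        ((fun m : ℕ => mse P ρ m (A m) i) =O[atTop] fun m : ℕ => 1 / (m : ℝ)) →
        (∀ m ω, IsEigenbasis (A m ω i) (b m ω)) →
        0 < α → α < 1 →
        (fun N : ℕ =>
            adaptiveInfidelity Ω P i ρ (⌊α * N⌋₊ / M) ((N - ⌊α * N⌋₊) / d ^ 2)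
              (b (⌊α * N⌋₊ / M)))
          =O[atTop] fun N : ℕ => 1 / (N : ℝ)) ∧
    -- the rate is optimal: no adaptive procedure has infidelity o(1 / N) at every POVM
    (∀ (σ : ℕ → List (Fin n) → Op d) (Q : (N : ℕ) → (Fin N → Fin n) → Op d),
      (∀ N h, IsState (σ N h)) → (∀ N ω, (Q N ω).PosSemidef) →
      ∃ P : Fin n → Op d, IsPOVM P ∧ P i ≠ 0 ∧
        ¬ (fun N : ℕ => sequentialInfidelity P i N (σ N) (Q N))
            =o[atTop] fun N : ℕ => 1 / (N : ℝ)) := by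
  have hc := hcomplete.complete
  -- An empty family of probe states would force `1 = 0`, impossible for `d ≥ 1`; the division of
  -- the copies by `M` needs this.
  have hM : 0 < M := by
    rcases Nat.eq_zero_or_pos M with rfl | hM
    · have h1 : (1 : Op d) = 0 := hc 1 isHermitian_one fun j => j.elim0
      have h2 := congrArg rtr h1
      rw [rtr_one, rtr_zero] at h2
      have h3 : (1 : ℝ) ≤ d := by exact_mod_cast hd
      linarith
    · exact hM
  refine ⟨fun P hP h0 => ⟨mse_twoStage_isBigO hΩ hρ hc hP i, fun A b α hmse hb hα hα1 =>
    adaptiveInfidelity_isBigO hd hΩ hρ hM hP h0 A b hmse hb hα hα1⟩, fun σ Q hσ hQ => ?_⟩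
  have : Nontrivial (Fin n) := Fin.nontrivial_iff_two_le.mpr hn
  obtain ⟨i', hi'⟩ := exists_ne i
  obtain ⟨p, hp0, hp1, hp⟩ := exists_not_isLittleO_coinRisk hi' fun N ω => rtr (Q N ω) / d
  have hPOVM : IsPOVM fun k => coin i i' p k • (1 : Op d) := coin_isPOVM hi' hp0.le hp1.le
  refine ⟨_, hPOVM, fun h => ?_, fun h => hp (IsBigO.trans_isLittleO (IsBigO.of_bound 1 ?_) h)⟩
  · have h2 := congrArg rtr h
    have h3 : (1 : ℝ) ≤ d := by exact_mod_cast hd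
    simp [coin] at h2
    rcases h2 with h2 | h2
    · exact hp0.ne' h2
    · omega
  · refine Eventually.of_forall fun N => ?_
    rw [one_mul, Real.norm_of_nonneg]
    · exact (coinRisk_le_sequentialInfidelity hd hi' hp0.le hp1.le (hσ N) (hQ N)).trans
        (Real.le_norm_self _)
    · exact Finset.sum_nonneg fun ω _ => mul_nonneg (Finset.prod_nonneg
        fun k _ => coin_nonneg hp0.le hp1.le _) (sq_nonneg _)
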